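/- Let $n\ge 1$, let $C\in\mathbb R^{n\times n}$, and let $f:\mathbb R\times\mathbb R^n\to\mathbb R^n$ be continuous with $f(t,0)=0$ for all $t\in\mathbb R$. Let $\alpha=\min_j\operatorname{Re}\lambda_j$ and $\beta=\max_j\operatorname{Re}\lambda_j$, where $\lambda_j$ are the (complex) eigenvalues of $C$, and let $m_\alpha$ and $m_\beta$ be the maximal degrees of the elementary divisors of $C$ (over $\mathbb C$) that correspond to eigenvalues with real part equal to $\alpha$ and $\beta$, respectively. Let $\eta:[0,\infty)\to[0,\infty)$ be a function such that - $(C_3)$ $\|f(t,x_1)-f(t,x_2)\|\le\eta(t)\,\|x_1-x_2\|$ for all $t\ge 0$ and $x_1,x_2\in\mathbb R^n$; - $(C_4)$ $\displaystyle\int_0^\infty t^{m_\beta+m_\alpha-2}e^{(\beta-\alpha)t}\eta(t)\,dt<\infty$ (the integrand being Lebesgue integrable); - $(C_5)$ $\displaystyle\lim_{t\to\infty}\int_t^\infty (s-t)^{m_\alpha-1}s^{m_\beta-1}e^{\alpha(t-s)}e^{\beta s}\eta(s)\,ds=0$. Then the systems $y'=Cy+f(t,y)$ and $x'=Cx$ are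 asymptotically equivalent on $[t_0,\infty)$ for every $t_0>0$, and, if moreover $\eta$ is integrable on $(0,1]$, also on $[0,\infty)$. Here two systems are called asymptotically equivalent on $[t_0,\infty)$ if there is a homeomorphism $x\mapsto y$ from the set of all solutions $x:[t_0,\infty)\to\mathbb R^n$ of the linear system onto the set of all solutions $y:[t_0,\infty)\to\mathbb R^n$ of the quasilinear system (both with the topology of uniform convergence on compact sets) such that $x(t)-y(t)\to 0$ as $t\to\infty$ for each pair of corresponding solutions. -/

import Mathlib

open Set Filter Topology MeasureTheory Polynomial
open scoped Matrix DirectSum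

noncomputable section

namespace QuasilinearODE

/-- The phase space `ℝⁿ` with its Euclidean norm. -/
abbrev E (n : ℕ) : Type := EuclideanSpace ℝ (Fin n)

/-- The linear map of the complex space `ℂⁿ` given by a real square matrix. -/
def complexMap {n : ℕ} (A : Matrix (Fin n) (Fin n) ℝ) : Module.End ℂ (Fin n → ℂ) :=
  Matrix.toLin' (A.map (fun a : ℝ => (a : ℂ)))

/-- The set of real parts of the (complex) eigenvalues of a real square matrix. -/
def eigenRealParts {n : ℕ} (A : Matrix (Fin n) (Fin n) ℝ) : Set ℝ :=
  {r | ∃ z : ℂ, (complexMap A).HasEigenvalue z ∧ z.re = r}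

/-- The smallest real part of an eigenvalue. For `n ≥ 1` the set of real parts is finite and
nonempty, so that this is its minimum. -/
def minRe {n : ℕ} (A : Matrix (Fin n) (Fin n) ℝ) : ℝ := sInf (eigenRealParts A)

/-- The largest real part of an eigenvalue. -/
def maxRe {n : ℕ} (A : Matrix (Fin n) (Fin n) ℝ) : ℝ := sSup (eigenRealParts A)

/-- `q` is an elementary divisor over `ℂ` of the real square matrix `A`: the `ℂ[X]`-module `ℂⁿ`, on
which `X` acts as `A`, is a finite direct sum of cyclic modules `ℂ[X] / (pᵢ ^ eᵢ)` with `pᵢ` monic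
and irreducible and `eᵢ ≥ 1`, and `q` is one of the `pᵢ ^ eᵢ`. (By the structure theorem over a
principal ideal domain the family of the `pᵢ ^ eᵢ` does not depend on the decomposition.) -/
def IsElementaryDivisor {n : ℕ} (A : Matrix (Fin n) (Fin n) ℝ) (q : ℂ[X]) : Prop :=
  ∃ (k : ℕ) (p : Fin k → ℂ[X]) (e : Fin k → ℕ),
    (∀ i, (p i).Monic ∧ Irreducible (p i) ∧ 0 < e i) ∧
    Nonempty (Module.AEval' (complexMap A) ≃ₗ[ℂ[X]]
      ⨁ i : Fin k, ℂ[X] ⧸ Ideal.span {p i ^ e i}) ∧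
    ∃ i, q = p i ^ e i

/-- The maximal degree of the elementary divisors of `A` that belong to eigenvalues with real
part `r`. -/
def maxElementaryDegree {n : ℕ} (A : Matrix (Fin n) (Fin n) ℝ) (r : ℝ) : ℕ :=
  sSup {d | ∃ (q : ℂ[X]) (z : ℂ), IsElementaryDivisor A q ∧ q.IsRoot z ∧ z.re = r ∧
    q.natDegree = d}

/-- The set of solutions on `[t₀, ∞)` of `y' = F(t, y)`, as a subspace of the space of continuous
functions `[t₀, ∞) → ℝⁿ`, whose topology is that of uniform convergence on compact sets. At `t₀`
the derivative is one-sided. -/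
def Solutions {n : ℕ} (F : ℝ → E n → E n) (t₀ : ℝ) : Set C(Ici t₀, E n) :=
  {y | ∀ t : Ici t₀, HasDerivWithinAt (IciExtend y) (F t (y t)) (Ici t₀) t}

/-- The systems `y' = F(t, y)` and `x' = G(t, x)` are asymptotically equivalent on `[t₀, ∞)`: there
is a homeomorphism between their solutions such that corresponding solutions satisfy
`x(t) - y(t) → 0` as `t → ∞`. -/
def AsymptoticallyEquivalent {n : ℕ} (F G : ℝ → E n → E n) (t₀ : ℝ) : Prop :=
  ∃ h : Solutions G t₀ ≃ₜ Solutions F t₀,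
    ∀ x : Solutions G t₀,
      Tendsto (fun t : Ici t₀ => x.1 t - (h x).1 t) atTop (𝓝 0)

/-- The vector field `x ↦ C x` of the linear system. -/
def linearField {n : ℕ} (C : Matrix (Fin n) (Fin n) ℝ) : ℝ → E n → E n :=
  fun _ x => Matrix.toEuclideanCLM (n := Fin n) (𝕜 := ℝ) C x

/-- The vector field `(t, y) ↦ C y + f(t, y)` of the quasilinear system. -/
def quasilinearField {n : ℕ} (C : Matrix (Fin n) (Fin n) ℝ) (f : ℝ → E n → E n) :
    ℝ → E n → E n :=
  fun t y => Matrix.toEuclideanCLM (n := Fin n) (𝕜 := ℝ) C y + f t y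

end QuasilinearODE

end

/-! To a solution `y` of the quasilinear system corresponds `x(t) = y(t) + V(t)`, where `V(t)` is
the integral of `exp((t - s)C) f(s, y(s))` over `s > t`. Since `V' = CV - f(t, y)`, adding `V`
removes the forcing term and `x` solves the linear system. It must be shown that `y ↦ x` is a
homeomorphism and that `V(t) → 0`.

The elementary divisors bound `‖exp(tC)‖` by a multiple of `(1 + t)^(mβ - 1) e^(βt)` and
`‖exp(-tC)‖` by a multiple of `(1 + t)^(mα - 1) e^(-αt)`, for `t ≥ 0` (`exists_norm_flow_le`). With
`g(t) = (1 + |t|)^(mβ - 1) e^(βt)` this gives `‖exp((t - s)C)‖ η(s) g(s) ≤ h(s) g(t)`, where `h` is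
integrable by (C₄). For `s ≤ t`, Gronwall's inequality shows that solutions are Lipschitz in their
initial value in the norm weighted by `g`; hence uniform convergence on compact sets and weighted
uniform convergence agree on solutions (`weightedSolutionsHomeomorph`). For `t < s`, the estimate
controls `V`: after replacing `g` by an equivalent weight `g e^(-G)` with `G` bounded
(`exists_monotone_weight`), `y ↦ V` has Lipschitz constant 1/2, so `y ↦ y + V` is a homeomorphism of
the whole weighted space, and it matches the two solution sets. Finally (C₅) forces `V(t) → 0`. -/

namespace QuasilinearODE

/-! ### Elementary divisors and generalized eigenspaces. -/

theorem isTorsion_aeval' {n : ℕ} (A : Module.End ℂ (Fin n → ℂ)) :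
    Module.IsTorsion ℂ[X] (Module.AEval' A) := by
  intro x
  refine ⟨⟨minpoly ℂ A, mem_nonZeroDivisors_of_ne_zero
    (minpoly.ne_zero (Algebra.IsIntegral.isIntegral A))⟩, ?_⟩
  obtain ⟨v, rfl⟩ := (Module.AEval'.of A).surjective x
  change minpoly ℂ A • Module.AEval.of ℂ (Fin n → ℂ) A v = 0
  rw [← Module.AEval.of_aeval_smul, minpoly.aeval]
  simp

theorem exists_linearEquiv_directSum {M : Type*} [AddCommGroup M] [Module ℂ[X] M]
    [Module.Finite ℂ[X] M] (hM : Module.IsTorsion ℂ[X] M) :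
    ∃ (k : ℕ) (w : Fin k → ℂ) (e : Fin k → ℕ), (∀ i, 0 < e i) ∧
      Nonempty (M ≃ₗ[ℂ[X]] ⨁ i : Fin k, ℂ[X] ⧸ Ideal.span {(X - C (w i)) ^ e i}) := by
  classical
  obtain ⟨ι, _, p, hp, e, ⟨φ⟩⟩ := Module.equiv_directSum_of_isTorsion hM
  have hroot : ∀ i, ∃ z : ℂ, Associated (p i) (X - C z) := by
    intro i
    obtain ⟨z, hz⟩ := IsAlgClosed.exists_root (p i)
      (by rw [IsAlgClosed.degree_eq_one_of_irreducible ℂ (hp i)]; exact one_ne_zero)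
    exact ⟨z, ((irreducible_X_sub_C z).associated_of_dvd (hp i) (dvd_iff_isRoot.2 hz)).symm⟩
  choose z hz using hroot
  have hspan : ∀ i, Ideal.span {p i ^ e i} = Ideal.span {(X - C (z i)) ^ e i} := fun i =>
    Ideal.span_singleton_eq_span_singleton.2 ((hz i).pow_pow)
  -- The structure theorem allows exponents 0, whose summands are trivial. `σ` enumerates the other
  -- indices, and `T` forgets the trivial summands.
  let σ : Fin (Fintype.card {i // 0 < e i}) → ι := fun j => ((Fintype.equivFin _).symm j).1
  have hσ : Function.Injective σ := Subtype.val_injective.comp (Equiv.injective _)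
  have hσr : ∀ i, 0 < e i → ∃ j, σ j = i := fun i hi =>
    ⟨Fintype.equivFin _ ⟨i, hi⟩, by simp [σ]⟩
  let N : ι → Type := fun i => ℂ[X] ⧸ Ideal.span {p i ^ e i}
  let T : (∀ i, N i) →ₗ[ℂ[X]] (∀ j, N (σ j)) := LinearMap.pi fun j => LinearMap.proj (σ j)
  have hT : Function.Bijective T := by
    constructor
    · intro f g hfg
      funext i
      by_cases hi : 0 < e i
      · obtain ⟨j, rfl⟩ := hσr i hi
        exact congrFun hfg j
      · have : Subsingleton (N i) := by
          have h0 : e i = 0 := by omega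
          simp only [N, h0, pow_zero, Ideal.span_singleton_one]
          infer_instance
        exact Subsingleton.elim _ _
    · intro g
      have : ∀ i, ∃ a : N i, ∀ j (h : i = σ j), h ▸ a = g j := by
        intro i
        by_cases hi : ∃ j, σ j = i
        · obtain ⟨j, rfl⟩ := hi
          refine ⟨g j, fun j' h => ?_⟩
          obtain rfl := hσ h
          rfl
        · exact ⟨0, fun j h => (hi ⟨j, h.symm⟩).elim⟩
      choose f hf using this
      exact ⟨f, funext fun j => hf (σ j) j rfl⟩
  refine ⟨_, fun j => z (σ j), fun j => e (σ j), fun j => ((Fintype.equivFin _).symm j).2, ⟨?_⟩⟩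
  refine φ.trans <| (DirectSum.linearEquivFunOnFintype ℂ[X] ι _).trans <|
    (LinearEquiv.ofBijective T hT).trans <| (LinearEquiv.piCongrRight fun j =>
      Submodule.quotEquivOfEq _ _ (hspan (σ j))).trans
      (DirectSum.linearEquivFunOnFintype ℂ[X] _ _).symm

/-- The minimal polynomial annihilates the module, in particular the class of 1 in each cyclic
summand. This bounds the degrees, so that the supremum in `maxElementaryDegree` is a true one and
not the default value 0. -/
theorem IsElementaryDivisor.dvd_minpoly {n : ℕ} {A : Matrix (Fin n) (Fin n) ℝ} {q : ℂ[X]}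
    (hq : IsElementaryDivisor A q) : q ∣ minpoly ℂ (complexMap A) := by
  obtain ⟨k, p, e, -, ⟨φ⟩, i, rfl⟩ := hq
  rw [← Ideal.mem_span_singleton, ← Ideal.Quotient.eq_zero_iff_mem]
  have h0 : ∀ x : ⨁ i : Fin k, ℂ[X] ⧸ Ideal.span {p i ^ e i},
      minpoly ℂ (complexMap A) • x = 0 := by
    intro x
    obtain ⟨y, rfl⟩ := φ.surjective x
    obtain ⟨v, rfl⟩ := (Module.AEval'.of (complexMap A)).surjective y
    have : minpoly ℂ (complexMap A) • Module.AEval.of ℂ (Fin n → ℂ) (complexMap A) v = 0 := by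
      rw [← Module.AEval.of_aeval_smul, minpoly.aeval]
      simp
    rw [← map_smul]
    erw [this]
    simp
  have h1 := congrArg (fun x => x i) (h0 (DirectSum.of _ i 1))
  simp only [DirectSum.smul_apply, DirectSum.of_eq_same, DirectSum.zero_apply] at h1
  rw [← h1]
  change _ = Ideal.Quotient.mk (Ideal.span {p i ^ e i}) (minpoly ℂ (complexMap A) * 1)
  rw [mul_one]

theorem bddAbove_elementaryDegrees {n : ℕ} (A : Matrix (Fin n) (Fin n) ℝ) (r : ℝ) :
    BddAbove {d | ∃ (q : ℂ[X]) (z : ℂ), IsElementaryDivisor A q ∧ q.IsRoot z ∧ z.re = r ∧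
      q.natDegree = d} := by
  refine ⟨(minpoly ℂ (complexMap A)).natDegree, ?_⟩
  rintro d ⟨q, z, hq, -, -, rfl⟩
  exact natDegree_le_of_dvd hq.dvd_minpoly
    (minpoly.ne_zero (Algebra.IsIntegral.isIntegral _))

theorem exists_decomposition {n : ℕ} (A : Matrix (Fin n) (Fin n) ℝ) :
    ∃ (k : ℕ) (w : Fin k → ℂ) (e : Fin k → ℕ), (∀ i, 0 < e i) ∧
      (∀ i, e i ≤ maxElementaryDegree A (w i).re) ∧
      Nonempty (Module.AEval' (complexMap A) ≃ₗ[ℂ[X]]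
        ⨁ i : Fin k, ℂ[X] ⧸ Ideal.span {(X - C (w i)) ^ e i}) := by
  obtain ⟨k, w, e, he, φ⟩ := exists_linearEquiv_directSum (isTorsion_aeval' (complexMap A))
  refine ⟨k, w, e, he, fun i => ?_, φ⟩
  refine le_csSup (bddAbove_elementaryDegrees A _) ⟨(X - C (w i)) ^ e i, w i,
    ⟨k, fun i => X - C (w i), e, fun i => ⟨monic_X_sub_C _, irreducible_X_sub_C _, he i⟩,
      φ, i, rfl⟩, ?_, rfl, ?_⟩
  · simp [IsRoot, (he i).ne']
  · simp [natDegree_pow]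

theorem pow_X_sub_C_smul_aeval' {n : ℕ} (A : Module.End ℂ (Fin n → ℂ)) (z : ℂ) (m : ℕ) (v : Fin n → ℂ) :
    (X - C z) ^ m • Module.AEval'.of A v
      = Module.AEval'.of A (((A - algebraMap ℂ _ z) ^ m) v) := by
  change (X - C z) ^ m • Module.AEval.of ℂ (Fin n → ℂ) A v = _
  rw [← Module.AEval.of_aeval_smul]
  simp

theorem smul_quotient_span_eq_zero {R : Type*} [CommRing R] (q : R) (x : R ⧸ Ideal.span {q}) :
    q • x = 0 := by
  obtain ⟨y, rfl⟩ := Ideal.Quotient.mk_surjective x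
  exact Ideal.Quotient.eq_zero_iff_mem.2
    (Ideal.mul_mem_right y _ (Ideal.mem_span_singleton_self q))

theorem mk_eq_zero_of_pow_smul {z w : ℂ} (hzw : w ≠ z) {N e : ℕ}
    (x : ℂ[X] ⧸ Ideal.span {(X - C w) ^ e}) (hx : (X - C z) ^ N • x = 0) : x = 0 := by
  have hcop : IsCoprime ((X - C w) ^ e) ((X - C z) ^ N) :=
    ((isCoprime_X_sub_C_of_isUnit_sub (sub_ne_zero.2 hzw).isUnit)).pow
  obtain ⟨a, b, hab⟩ := hcop
  have h1 : (X - C w) ^ e • x = 0 := smul_quotient_span_eq_zero _ x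
  rw [← one_smul ℂ[X] x, ← hab, add_smul, mul_smul, mul_smul, h1, hx, smul_zero, smul_zero,
    add_zero]

/-- Some power of `X - z` kills `v`. In a summand for `w ≠ z` this power is coprime to the modulus,
so the component of `v` vanishes; in a summand for `z` the exponent is at most the maximal degree.
-/
theorem pow_maxElementaryDegree_apply_eq_zero {n : ℕ} (A : Matrix (Fin n) (Fin n) ℝ) {z : ℂ}
    {v : Fin n → ℂ} (hv : v ∈ (complexMap A).maxGenEigenspace z) :
    ((complexMap A - algebraMap ℂ _ z) ^ maxElementaryDegree A z.re) v = 0 := by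
  obtain ⟨k, w, e, -, hle, ⟨φ⟩⟩ := exists_decomposition A
  obtain ⟨N, hN⟩ := (Module.End.mem_maxGenEigenspace _ _ _).1 hv
  have hN' : ((complexMap A - algebraMap ℂ _ z) ^ N) v = 0 := hN
  apply (Module.AEval'.of (complexMap A)).injective
  rw [← pow_X_sub_C_smul_aeval', map_zero]
  apply φ.injective
  rw [map_smul, map_zero]
  have h1 : (X - C z) ^ N • φ (Module.AEval'.of (complexMap A) v) = 0 := by
    rw [← map_smul, pow_X_sub_C_smul_aeval', hN', map_zero, map_zero]
  set x := φ (Module.AEval'.of (complexMap A) v)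
  refine DFinsupp.ext fun i => ?_
  have h2 : (X - C z) ^ N • x i = 0 := congrArg (fun y => y i) h1
  change (X - C z) ^ _ • x i = 0
  by_cases hi : w i = z
  · obtain ⟨d, hd⟩ := Nat.exists_eq_add_of_le (hle i)
    rw [← hi, hd, pow_add, mul_comm, mul_smul, smul_quotient_span_eq_zero _ (x i), smul_zero]
  · rw [mk_eq_zero_of_pow_smul hi _ h2, smul_zero]

/-- With degree 0 the zeroth power, the identity, would kill an eigenvector. This makes the
truncated subtraction `m - 1` genuine later on. -/
theorem one_le_maxElementaryDegree {n : ℕ} (A : Matrix (Fin n) (Fin n) ℝ) {z : ℂ}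
    (hz : (complexMap A).HasEigenvalue z) : 1 ≤ maxElementaryDegree A z.re := by
  obtain ⟨v, hv⟩ := hz.exists_hasEigenvector
  by_contra hlt
  have h0 : maxElementaryDegree A z.re = 0 := by omega
  have := pow_maxElementaryDegree_apply_eq_zero A
    (Module.End.mem_maxGenEigenspace _ _ _ |>.2 ⟨1, by
      simpa [sub_eq_zero] using hv.apply_eq_smul⟩ : v ∈ (complexMap A).maxGenEigenspace z)
  rw [h0] at this
  exact hv.2 (by simpa using this)

theorem finite_eigenRealParts {n : ℕ} (A : Matrix (Fin n) (Fin n) ℝ) :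
    (eigenRealParts A).Finite := by
  have : eigenRealParts A = Complex.re '' {z | (complexMap A).HasEigenvalue z} := by
    ext r; simp [eigenRealParts]
  rw [this]
  exact (Module.End.finite_hasEigenvalue _).image _

theorem nonempty_eigenRealParts {n : ℕ} (hn : 1 ≤ n) (A : Matrix (Fin n) (Fin n) ℝ) :
    (eigenRealParts A).Nonempty := by
  have : NeZero n := ⟨by omega⟩
  obtain ⟨z, hz⟩ := Module.End.exists_eigenvalue (complexMap A)
  exact ⟨z.re, z, hz, rfl⟩

theorem one_le_maxElementaryDegree_of_mem {n : ℕ} (A : Matrix (Fin n) (Fin n) ℝ) {r : ℝ}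
    (hr : r ∈ eigenRealParts A) : 1 ≤ maxElementaryDegree A r := by
  obtain ⟨z, hz, rfl⟩ := hr
  exact one_le_maxElementaryDegree A hz

end QuasilinearODE

/-! ### Growth of the matrix exponential. -/

namespace QuasilinearODE

theorem exp_apply_of_pow_apply_eq_zero {V : Type*} [NormedAddCommGroup V] [NormedSpace ℂ V]
    [CompleteSpace V] (N : V →L[ℂ] V) {m : ℕ} {v : V} (hv : (N ^ m) v = 0) :
    NormedSpace.exp N v = ∑ j ∈ Finset.range m, ((j.factorial : ℂ)⁻¹) • (N ^ j) v := by
  have h1 := (NormedSpace.exp_series_hasSum_exp' (𝕂 := ℂ) N).mapL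
    (ContinuousLinearMap.apply ℂ V v)
  refine h1.unique ?_
  refine hasSum_sum_of_ne_finset_zero fun j hj => ?_
  obtain ⟨d, rfl⟩ := Nat.exists_eq_add_of_le (not_lt.1 (Finset.mem_range.not.1 hj))
  have : (N ^ (m + d)) v = 0 := by
    rw [add_comm, pow_add, mul_apply_eq_comp, hv, map_zero]
  simp [this]

/-- Write `S = z + N` with commuting summands. The series of `exp(tN) v` stops before degree `m`,
and the scalar factor has modulus `e^(t Re z)`. -/
theorem exists_norm_exp_smul_apply_le_of_pow_apply_eq_zero {V : Type*} [NormedAddCommGroup V]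
    [NormedSpace ℂ V] [CompleteSpace V] (S : V →L[ℂ] V) (z : ℂ) {m : ℕ} {v : V}
    (hv : ((S - algebraMap ℂ (V →L[ℂ] V) z) ^ m) v = 0) :
    ∃ K : ℝ, 0 ≤ K ∧ ∀ t : ℝ,
      ‖NormedSpace.exp ((t : ℂ) • S) v‖ ≤ K * (1 + |t|) ^ (m - 1) * Real.exp (t * z.re) := by
  let _ : NormedAlgebra ℚ (V →L[ℂ] V) := NormedAlgebra.restrictScalars ℚ ℂ _
  set N := S - algebraMap ℂ (V →L[ℂ] V) z with hN
  refine ⟨∑ j ∈ Finset.range m, ‖(N ^ j) v‖, by positivity, fun t => ?_⟩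
  have hS : (t : ℂ) • S = algebraMap ℂ (V →L[ℂ] V) (t * z) + (t : ℂ) • N := by
    rw [hN, smul_sub, Algebra.algebraMap_eq_smul_one, Algebra.algebraMap_eq_smul_one, smul_smul]
    abel
  have h0 : (((t : ℂ) • N) ^ m) v = 0 := by
    rw [_root_.smul_pow, _root_.smul_apply, hv, smul_zero]
  rw [hS, NormedSpace.exp_add_of_commute (Algebra.commutes _ _), ← NormedSpace.algebraMap_exp_comm,
    mul_apply_eq_comp, exp_apply_of_pow_apply_eq_zero _ h0,
    Algebra.algebraMap_eq_smul_one, _root_.smul_apply,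
    one_apply_eq_self, norm_smul, ← Complex.exp_eq_exp_ℂ, Complex.norm_exp]
  have hre : ((t : ℂ) * z).re = t * z.re := by simp
  rw [hre, mul_comm]
  gcongr
  refine (norm_sum_le _ _).trans ?_
  rw [Finset.sum_mul]
  refine Finset.sum_le_sum fun j hj => ?_
  have hj' := Finset.mem_range.1 hj
  rw [_root_.smul_pow, _root_.smul_apply, norm_smul, norm_smul, mul_comm (‖(N ^ j) v‖),
    ← mul_assoc]
  gcongr
  have h1 : ‖((j.factorial : ℂ)⁻¹)‖ ≤ 1 := by
    rw [norm_inv, Complex.norm_natCast]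
    exact inv_le_one_of_one_le₀ (by exact_mod_cast Nat.one_le_iff_ne_zero.2 j.factorial_ne_zero)
  have h2 : ‖(t : ℂ) ^ j‖ ≤ (1 + |t|) ^ (m - 1) := by
    rw [norm_pow, Complex.norm_real, Real.norm_eq_abs]
    calc |t| ^ j ≤ (1 + |t|) ^ j := by gcongr; linarith
      _ ≤ (1 + |t|) ^ (m - 1) := pow_le_pow_right₀ (by linarith [abs_nonneg t]) (by omega)
  calc _ ≤ 1 * (1 + |t|) ^ (m - 1) := mul_le_mul h1 h2 (norm_nonneg _) zero_le_one
    _ = _ := one_mul _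

/-- The constant comes from `u^d / d! ≤ e^u` at `u = (b - a)(1 + t)`. -/
theorem exists_pow_mul_exp_le (d : ℕ) {a b : ℝ} (hab : a < b) :
    ∃ K : ℝ, 0 ≤ K ∧ ∀ t : ℝ, 0 ≤ t → (1 + t) ^ d * Real.exp (a * t) ≤ K * Real.exp (b * t) := by
  have hε : 0 < b - a := sub_pos.2 hab
  refine ⟨d.factorial / (b - a) ^ d * Real.exp (b - a), by positivity, fun t ht => ?_⟩
  have h := Real.pow_div_factorial_le_exp ((b - a) * (1 + t)) (by positivity) d
  rw [mul_pow, div_le_iff₀ (by positivity)] at h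
  have h3 : (1 + t) ^ d ≤ d.factorial / (b - a) ^ d * Real.exp ((b - a) * (1 + t)) := by
    rw [div_mul_eq_mul_div, le_div_iff₀ (by positivity)]
    linarith
  calc (1 + t) ^ d * Real.exp (a * t)
      ≤ d.factorial / (b - a) ^ d * Real.exp ((b - a) * (1 + t)) * Real.exp (a * t) := by gcongr
    _ = d.factorial / (b - a) ^ d * (Real.exp (b - a) * Real.exp (b * t)) := by
      rw [mul_assoc, ← Real.exp_add, ← Real.exp_add]; ring_nf
    _ = _ := by ring

theorem hasEigenvalue_of_mem_maxGenEigenspace {V : Type*} [AddCommGroup V] [Module ℂ V]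
    {T : Module.End ℂ V} {z : ℂ} {v : V} (hv : v ∈ T.maxGenEigenspace z) (hv0 : v ≠ 0) :
    T.HasEigenvalue z := by
  intro hbot
  have hinj : Function.Injective (T - z • (1 : Module.End ℂ V)) := by
    rw [← LinearMap.ker_eq_bot, ← Module.End.eigenspace_def]
    exact hbot
  obtain ⟨k, hk⟩ := (Module.End.mem_maxGenEigenspace _ _ _).1 hv
  refine hv0 ((hinj.iterate k) ?_)
  rw [← Module.End.pow_apply, hk, ← Module.End.pow_apply, map_zero]

/-- The sign `σ` treats forward and backward time together. It suffices to consider generalized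
eigenvectors: those with `σ Re z < r` absorb their polynomial factor into the exponential, and only
the extremal ones determine the power. -/
theorem exists_norm_exp_complexMap_apply_le {n : ℕ} (A : Matrix (Fin n) (Fin n) ℝ) {σ r : ℝ}
    (hσ : |σ| = 1) {m : ℕ}
    (h : ∀ z, (complexMap A).HasEigenvalue z → σ * z.re ≤ r ∧
      (σ * z.re = r → maxElementaryDegree A z.re ≤ m)) (v : Fin n → ℂ) :
    ∃ K : ℝ, 0 ≤ K ∧ ∀ t : ℝ, 0 ≤ t →
      ‖NormedSpace.exp (((σ * t : ℝ) : ℂ) • LinearMap.toContinuousLinearMap (complexMap A)) v‖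
        ≤ K * ((1 + t) ^ (m - 1) * Real.exp (r * t)) := by
  have hv : v ∈ ⨆ z, (complexMap A).maxGenEigenspace z := by
    rw [Module.End.iSup_maxGenEigenspace_eq_top]; trivial
  induction hv using Submodule.iSup_induction' with
  | zero => exact ⟨0, le_rfl, fun t _ => by simp⟩
  | add x y _ _ hx hy =>
    obtain ⟨K₁, h₁, hx⟩ := hx
    obtain ⟨K₂, h₂, hy⟩ := hy
    refine ⟨K₁ + K₂, add_nonneg h₁ h₂, fun t ht => ?_⟩
    rw [map_add, add_mul]
    exact (norm_add_le _ _).trans (add_le_add (hx t ht) (hy t ht))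
  | mem z v hv =>
    by_cases hv0 : v = 0
    · exact ⟨0, le_rfl, fun t _ => by simp [hv0]⟩
    obtain ⟨hle, heq⟩ := h z (hasEigenvalue_of_mem_maxGenEigenspace hv hv0)
    have hpow : ((LinearMap.toContinuousLinearMap (complexMap A) -
        algebraMap ℂ ((Fin n → ℂ) →L[ℂ] (Fin n → ℂ)) z) ^ maxElementaryDegree A z.re) v = 0 := by
      have h1 := pow_maxElementaryDegree_apply_eq_zero A hv
      rw [Module.End.pow_apply] at h1
      rw [FunLike.coe_pow_eq_iterate]
      exact h1
    obtain ⟨K, hK, hb⟩ := exists_norm_exp_smul_apply_le_of_pow_apply_eq_zero _ z hpow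
    have hb' : ∀ t : ℝ, 0 ≤ t →
        ‖NormedSpace.exp (((σ * t : ℝ) : ℂ) • LinearMap.toContinuousLinearMap (complexMap A)) v‖
        ≤ K * ((1 + t) ^ (maxElementaryDegree A z.re - 1) * Real.exp ((σ * z.re) * t)) := by
      intro t ht
      refine (hb (σ * t)).trans (le_of_eq ?_)
      rw [abs_mul, hσ, one_mul, abs_of_nonneg ht, mul_assoc]
      ring_nf
    rcases hle.lt_or_eq with hlt | he
    · obtain ⟨K', hK', hb2⟩ := exists_pow_mul_exp_le (maxElementaryDegree A z.re - 1) hlt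
      refine ⟨K * K', mul_nonneg hK hK', fun t ht => (hb' t ht).trans ?_⟩
      rw [mul_assoc K K']
      refine mul_le_mul_of_nonneg_left ((hb2 t ht).trans ?_) hK
      refine mul_le_mul_of_nonneg_left ?_ hK'
      exact le_mul_of_one_le_left (Real.exp_pos _).le (one_le_pow₀ (by linarith))
    · refine ⟨K, hK, fun t ht => (hb' t ht).trans ?_⟩
      rw [he]
      gcongr
      · linarith
      · exact heq he

/-- The inclusion of `ℝⁿ` in `ℂⁿ`. -/
noncomputable def complexify (n : ℕ) : E n →L[ℝ] (Fin n → ℂ) :=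
  ContinuousLinearMap.pi fun i => Complex.ofRealCLM.comp (EuclideanSpace.proj i)

theorem complexify_apply {n : ℕ} (x : E n) (i : Fin n) : complexify n x i = (x i : ℂ) := rfl

theorem complexify_toEuclideanCLM {n : ℕ} (A : Matrix (Fin n) (Fin n) ℝ) (x : E n) :
    complexify n (Matrix.toEuclideanCLM (n := Fin n) (𝕜 := ℝ) A x)
      = complexMap A (complexify n x) := by
  funext i
  simp [complexify_apply, complexMap, Matrix.mulVec, dotProduct]

theorem complexify_exp {n : ℕ} (A : Matrix (Fin n) (Fin n) ℝ) (t : ℝ) (x : E n) :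
    complexify n (NormedSpace.exp (t • Matrix.toEuclideanCLM (n := Fin n) (𝕜 := ℝ) A) x)
      = NormedSpace.exp ((t : ℂ) • LinearMap.toContinuousLinearMap (complexMap A))
        (complexify n x) := by
  have h1 := ((NormedSpace.exp_series_hasSum_exp' (𝕂 := ℝ)
    (t • Matrix.toEuclideanCLM (n := Fin n) (𝕜 := ℝ) A)).mapL
    (ContinuousLinearMap.apply ℝ (E n) x)).mapL (complexify n)
  have h2 := (NormedSpace.exp_series_hasSum_exp' (𝕂 := ℂ)
    ((t : ℂ) • LinearMap.toContinuousLinearMap (complexMap A))).mapL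
    (ContinuousLinearMap.apply ℂ (Fin n → ℂ) (complexify n x))
  have hpow : ∀ j : ℕ,
      complexify n (((t • Matrix.toEuclideanCLM (n := Fin n) (𝕜 := ℝ) A) ^ j) x)
        = (((t : ℂ) • LinearMap.toContinuousLinearMap (complexMap A)) ^ j) (complexify n x) := by
    intro j
    induction j with
    | zero => simp
    | succ j ih =>
      rw [pow_succ', pow_succ', mul_apply_eq_comp, mul_apply_eq_comp, _root_.smul_apply,
        _root_.smul_apply, map_smul, complexify_toEuclideanCLM, ih]
      rfl
  refine h1.unique ?_
  convert h2 using 1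
  · rfl
  · rfl
  · refine _root_.funext fun j => ?_
    simp only [ContinuousLinearMap.apply_apply, map_smul, hpow]
    funext i
    simp
  · rfl

theorem exists_norm_le_norm_complexify (n : ℕ) : ∃ K : ℝ, 0 ≤ K ∧ ∀ x : E n,
    ‖x‖ ≤ K * ‖complexify n x‖ := by
  have hker : LinearMap.ker (complexify n : E n →ₗ[ℝ] (Fin n → ℂ)) = ⊥ := by
    rw [LinearMap.ker_eq_bot]
    intro x y hxy
    ext i
    have := congrFun hxy i
    exact Complex.ofReal_injective this
  obtain ⟨K, -, hK⟩ := LinearMap.exists_antilipschitzWith _ hker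
  exact ⟨K, K.2, fun x => by simpa using hK.le_mul_dist x 0⟩

theorem exists_norm_exp_le {n : ℕ} (A : Matrix (Fin n) (Fin n) ℝ) {σ r : ℝ}
    (hσ : |σ| = 1) {m : ℕ}
    (h : ∀ z, (complexMap A).HasEigenvalue z → σ * z.re ≤ r ∧
      (σ * z.re = r → maxElementaryDegree A z.re ≤ m)) :
    ∃ K : ℝ, 0 ≤ K ∧ ∀ t : ℝ, 0 ≤ t →
      ‖NormedSpace.exp ((σ * t) • Matrix.toEuclideanCLM (n := Fin n) (𝕜 := ℝ) A)‖
        ≤ K * ((1 + t) ^ (m - 1) * Real.exp (r * t)) := by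
  obtain ⟨K₀, hK₀, hle⟩ := exists_norm_le_norm_complexify n
  have hpos : ∀ t : {t : ℝ // 0 ≤ t}, 0 < (1 + t.1) ^ (m - 1) * Real.exp (r * t) := fun t =>
    mul_pos (pow_pos (by linarith [t.2]) _) (Real.exp_pos _)
  -- The bounds so far have constants depending on the vector; uniform boundedness turns them into
  -- an operator norm bound.
  obtain ⟨K, hK⟩ := banach_steinhaus (𝕜 := ℝ) (𝕜₂ := ℝ) (E := E n) (F := E n)
    (g := fun t : {t : ℝ // 0 ≤ t} => ((1 + t.1) ^ (m - 1) * Real.exp (r * t))⁻¹ •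
      NormedSpace.exp ((σ * t.1) • Matrix.toEuclideanCLM (n := Fin n) (𝕜 := ℝ) A)) (by
    intro x
    obtain ⟨K, -, hb⟩ := exists_norm_exp_complexMap_apply_le A hσ h (complexify n x)
    refine ⟨K₀ * K, fun t => ?_⟩
    rw [_root_.smul_apply, norm_smul, norm_inv, Real.norm_of_nonneg (hpos t).le,
      inv_mul_le_iff₀ (hpos t)]
    refine (hle _).trans ?_
    rw [complexify_exp]
    calc _ ≤ K₀ * (K * ((1 + t.1) ^ (m - 1) * Real.exp (r * t))) := by
          gcongr
          exact hb t t.2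
      _ = _ := by ring)
  refine ⟨max K 0, le_max_right _ _, fun t ht => ?_⟩
  have := hK ⟨t, ht⟩
  rw [norm_smul, norm_inv, Real.norm_of_nonneg (hpos ⟨t, ht⟩).le,
      inv_mul_le_iff₀ (hpos ⟨t, ht⟩)] at this
  refine this.trans ?_
  rw [mul_comm]
  exact mul_le_mul_of_nonneg_right (le_max_left _ _) (hpos ⟨t, ht⟩).le

end QuasilinearODE

/-! ### Exponential weights and Gronwall's inequality. -/

namespace QuasilinearODE

/-- The primitive of `h` need not be differentiable everywhere, so `h` is replaced by a continuous
`k` at L¹ distance at most 1/4, and `G` is the primitive of `4|k|`. The part with `|k|` integrates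
exactly and costs 1/4; the rest costs 1/4 because `G` is monotone. The tail estimate serves the
contraction, the other one Gronwall's inequality. -/
theorem exists_monotone_weight {a : ℝ} {h : ℝ → ℝ} (hint : IntegrableOn h (Ioi a)) :
    ∃ (G : ℝ → ℝ) (M : ℝ), Continuous G ∧ (∀ t, a ≤ t → 0 ≤ G t ∧ G t ≤ M) ∧
      (∀ t, a ≤ t → ∫ s in Ioi t, h s * Real.exp (-G s) ≤ 1 / 2 * Real.exp (-G t)) ∧
      (∀ t, a ≤ t → ∫ s in Ioc a t, h s * Real.exp (G s) ≤ 1 / 2 * Real.exp (G t)) := by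
  obtain ⟨k, -, hk, hkc, hki⟩ := ((integrable_indicator_iff measurableSet_Ioi).2
    hint).exists_hasCompactSupport_integral_sub_le (show (0 : ℝ) < 1 / 4 by norm_num)
  have hkabs : Continuous fun s => |k s| := hkc.abs
  have hr : IntegrableOn (fun s => |h s - k s|) (Ioi a) := (hint.sub hki.integrableOn).abs
  have hr4 : ∫ s in Ioi a, |h s - k s| ≤ 1 / 4 := by
    refine le_trans ?_ hk
    rw [← integral_indicator measurableSet_Ioi]
    refine integral_mono ((integrable_indicator_iff measurableSet_Ioi).2 hr)
      (((integrable_indicator_iff measurableSet_Ioi).2 hint).sub hki).norm fun s => ?_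
    by_cases hs : s ∈ Ioi a <;> simp [hs]
  set G : ℝ → ℝ := fun t => ∫ s in a..t, 4 * |k s| with hG
  have hG' : ∀ t, HasDerivAt G (4 * |k t|) t := fun t =>
    (continuous_const.mul hkabs).integral_hasStrictDerivAt a t |>.hasDerivAt
  have hGc : Continuous G := continuous_iff_continuousAt.2 fun t => (hG' t).continuousAt
  have hGm : Monotone G := monotone_of_deriv_nonneg (fun t => (hG' t).differentiableAt) fun t => by
    rw [(hG' t).deriv]; positivity
  have hGa : G a = 0 := intervalIntegral.integral_same
  have hGlim : Tendsto G atTop (𝓝 (∫ s in Ioi a, 4 * |k s|)) :=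
    intervalIntegral_tendsto_integral_Ioi a (hki.abs.const_mul 4).integrableOn tendsto_id
  have hexp : ∀ t, HasDerivAt (fun s => 1 / 4 * Real.exp (G s)) (|k t| * Real.exp (G t)) t := by
    intro t
    refine ((hG' t).exp.const_mul (1 / 4)).congr_deriv ?_
    ring
  have hexpn : ∀ t,
      HasDerivAt (fun s => -(1 / 4) * Real.exp (-G s)) (|k t| * Real.exp (-G t)) t := by
    intro t
    refine ((hG' t).neg.exp.const_mul (-(1 / 4))).congr_deriv ?_
    rw [Pi.neg_apply]
    ring
  have hb : ∀ t, G t ≤ ∫ s in Ioi a, 4 * |k s| := fun t => hGm.ge_of_tendsto hGlim t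
  refine ⟨G, ∫ s in Ioi a, 4 * |k s|, hGc, fun t ht => ⟨hGa ▸ hGm ht, hb t⟩, ?_, ?_⟩
  · intro t ht
    have hsub : Ioi t ⊆ Ioi a := Ioi_subset_Ioi ht
    have hbd : ∀ s ∈ Ioi t, ‖Real.exp (-G s)‖ ≤ Real.exp (-G t) := fun s hs => by
      rw [Real.norm_of_nonneg (Real.exp_pos _).le]
      exact Real.exp_le_exp.2 (neg_le_neg (hGm (le_of_lt hs)))
    have hmeas : AEStronglyMeasurable (fun s => Real.exp (-G s)) (volume.restrict (Ioi t)) :=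
      (Real.continuous_exp.comp hGc.neg).aestronglyMeasurable
    have hbd' := (ae_restrict_iff' (μ := volume) (measurableSet_Ioi (a := t))).2
      (Eventually.of_forall hbd)
    have i1 : IntegrableOn (fun s => h s * Real.exp (-G s)) (Ioi t) :=
      Integrable.mul_bdd (hint.mono_set hsub) hmeas hbd'
    have i2 : IntegrableOn (fun s => |k s| * Real.exp (-G s)) (Ioi t) :=
      Integrable.mul_bdd hki.abs.integrableOn hmeas hbd'
    have i3 : IntegrableOn (fun s => |h s - k s| * Real.exp (-G t)) (Ioi t) :=
      (hr.mono_set hsub).mul_const _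
    have e2 : ∫ s in Ioi t, |k s| * Real.exp (-G s) ≤ 1 / 4 * Real.exp (-G t) := by
      rw [integral_Ioi_of_hasDerivAt_of_tendsto' (fun s _ => hexpn s) i2
        ((Real.continuous_exp.tendsto _).comp hGlim.neg |>.const_mul (-(1 / 4)))]
      have := Real.exp_pos (-∫ s in Ioi a, 4 * |k s|)
      linarith
    have e3 : ∫ s in Ioi t, |h s - k s| * Real.exp (-G t) ≤ 1 / 4 * Real.exp (-G t) := by
      rw [integral_mul_const]
      refine mul_le_mul_of_nonneg_right (le_trans ?_ hr4) (Real.exp_pos _).le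
      exact setIntegral_mono_set hr (Eventually.of_forall fun s => abs_nonneg _)
        hsub.eventuallyLE
    calc ∫ s in Ioi t, h s * Real.exp (-G s)
        ≤ ∫ s in Ioi t, (|k s| * Real.exp (-G s) + |h s - k s| * Real.exp (-G t)) := by
          refine setIntegral_mono_on i1 (i2.add i3) measurableSet_Ioi fun s hs => ?_
          have h1 : Real.exp (-G s) ≤ Real.exp (-G t) := (Real.norm_of_nonneg
            (Real.exp_pos (-G s)).le) ▸ hbd s hs
          have h2 : h s ≤ |k s| + |h s - k s| := by
            linarith [le_abs_self (k s), le_abs_self (h s - k s)]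
          calc h s * Real.exp (-G s) ≤ (|k s| + |h s - k s|) * Real.exp (-G s) := by gcongr
            _ = |k s| * Real.exp (-G s) + |h s - k s| * Real.exp (-G s) := add_mul _ _ _
            _ ≤ _ := by gcongr
      _ = _ := integral_add i2 i3
      _ ≤ 1 / 4 * Real.exp (-G t) + 1 / 4 * Real.exp (-G t) := add_le_add e2 e3
      _ = _ := by ring
  · intro t ht
    have hsub : Ioc a t ⊆ Ioi a := Ioc_subset_Ioi_self
    have hbd : ∀ s ∈ Ioc a t, ‖Real.exp (G s)‖ ≤ Real.exp (G t) := fun s hs => by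
      rw [Real.norm_of_nonneg (Real.exp_pos _).le]
      exact Real.exp_le_exp.2 (hGm hs.2)
    have hmeas : AEStronglyMeasurable (fun s => Real.exp (G s)) (volume.restrict (Ioc a t)) :=
      (Real.continuous_exp.comp hGc).aestronglyMeasurable
    have hbd' := (ae_restrict_iff' (μ := volume) (measurableSet_Ioc (a := a) (b := t))).2
      (Eventually.of_forall hbd)
    have i1 : IntegrableOn (fun s => h s * Real.exp (G s)) (Ioc a t) :=
      Integrable.mul_bdd (hint.mono_set hsub) hmeas hbd'
    have i2 : IntegrableOn (fun s => |k s| * Real.exp (G s)) (Ioc a t) :=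
      Integrable.mul_bdd hki.abs.integrableOn hmeas hbd'
    have i3 : IntegrableOn (fun s => |h s - k s| * Real.exp (G t)) (Ioc a t) :=
      (hr.mono_set hsub).mul_const _
    have e2 : ∫ s in Ioc a t, |k s| * Real.exp (G s) ≤ 1 / 4 * Real.exp (G t) := by
      rw [← intervalIntegral.integral_of_le ht,
        intervalIntegral.integral_eq_sub_of_hasDerivAt (fun s _ => hexp s)
          ((hkabs.mul (Real.continuous_exp.comp hGc)).intervalIntegrable _ _)]
      have := Real.exp_pos (G a)
      linarith
    have e3 : ∫ s in Ioc a t, |h s - k s| * Real.exp (G t) ≤ 1 / 4 * Real.exp (G t) := by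
      rw [integral_mul_const]
      refine mul_le_mul_of_nonneg_right (le_trans ?_ hr4) (Real.exp_pos _).le
      exact setIntegral_mono_set hr (Eventually.of_forall fun s => abs_nonneg _)
        hsub.eventuallyLE
    calc ∫ s in Ioc a t, h s * Real.exp (G s)
        ≤ ∫ s in Ioc a t, (|k s| * Real.exp (G s) + |h s - k s| * Real.exp (G t)) := by
          refine setIntegral_mono_on i1 (i2.add i3) measurableSet_Ioc fun s hs => ?_
          have h1 : Real.exp (G s) ≤ Real.exp (G t) := Real.exp_le_exp.2 (hGm hs.2)
          have h2 : h s ≤ |k s| + |h s - k s| := by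
            linarith [le_abs_self (k s), le_abs_self (h s - k s)]
          calc h s * Real.exp (G s) ≤ (|k s| + |h s - k s|) * Real.exp (G s) := by gcongr
            _ = |k s| * Real.exp (G s) + |h s - k s| * Real.exp (G s) := add_mul _ _ _
            _ ≤ _ := by gcongr
      _ = _ := integral_add i2 i3
      _ ≤ 1 / 4 * Real.exp (G t) + 1 / 4 * Real.exp (G t) := add_le_add e2 e3
      _ = _ := by ring

/-- Gronwall's inequality in integral form, with an integrable kernel. -/
theorem exists_bound_of_le_add_setIntegral {a : ℝ} {h : ℝ → ℝ} (hint : IntegrableOn h (Ioi a))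
    (hnn : ∀ s, a < s → 0 ≤ h s) :
    ∃ K : ℝ, 0 ≤ K ∧ ∀ (u : ℝ → ℝ) (c : ℝ), Continuous u → 0 ≤ c →
      (∀ t, a ≤ t → u t ≤ c + ∫ s in Ioc a t, h s * u s) → ∀ t, a ≤ t → u t ≤ K * c := by
  obtain ⟨G, M, hGc, hGb, -, hG⟩ := exists_monotone_weight hint
  refine ⟨2 * Real.exp M, by positivity, fun u c hu hc hle t ht => ?_⟩
  -- At a maximum point of `u e^(-G)`, with value `B`, the hypothesis reads `B e^(G b) ≤ c + (B e^(G
  -- b)) / 2` when `B > 0`, whence `B ≤ 2c`.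
  obtain ⟨b, hb, hmax⟩ := isCompact_Icc.exists_isMaxOn (nonempty_Icc.2 ht)
    (hu.mul (Real.continuous_exp.comp hGc.neg)).continuousOn
  set B := u b * Real.exp (-G b) with hB
  have hmax' : ∀ s ∈ Icc a t, u s ≤ B * Real.exp (G s) := by
    intro s hs
    have h1 : u s * Real.exp (-G s) ≤ B := hmax hs
    calc u s = u s * Real.exp (-G s) * Real.exp (G s) := by
          rw [mul_assoc, ← Real.exp_add, neg_add_cancel, Real.exp_zero, mul_one]
      _ ≤ _ := by gcongr
  have hbt : Ioc a b ⊆ Ioi a := Ioc_subset_Ioi_self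
  have hsub : ∀ s ∈ Ioc a b, s ∈ Icc a t := fun s hs => ⟨hs.1.le, hs.2.trans hb.2⟩
  have hbdd : ∀ v : ℝ → ℝ, Continuous v → IntegrableOn (fun s => h s * v s) (Ioc a b) := by
    intro v hv
    obtain ⟨D, hD⟩ := (isCompact_Icc (a := a) (b := b)).exists_bound_of_continuousOn
      hv.continuousOn
    exact Integrable.mul_bdd (c := D) (hint.mono_set hbt) hv.aestronglyMeasurable
      ((ae_restrict_iff' measurableSet_Ioc).2 (Eventually.of_forall fun s hs =>
        hD s (Ioc_subset_Icc_self hs)))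
  have hI : ∫ s in Ioc a b, h s * u s ≤ B * ∫ s in Ioc a b, h s * Real.exp (G s) := by
    rw [← integral_const_mul]
    refine setIntegral_mono_on (hbdd u hu)
      ((hbdd _ (Real.continuous_exp.comp hGc)).const_mul B) measurableSet_Ioc fun s hs => ?_
    have := mul_le_mul_of_nonneg_left (hmax' s (hsub s hs)) (hnn s hs.1)
    linarith
  rcases le_or_gt B 0 with hB0 | hB0
  · have h1 : u t ≤ 0 := (hmax' t ⟨ht, le_rfl⟩).trans
      (mul_nonpos_of_nonpos_of_nonneg hB0 (Real.exp_pos _).le)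
    exact h1.trans (by positivity)
  · have h1 : u b ≤ c + B * (1 / 2 * Real.exp (G b)) := (hle b hb.1).trans <| by
      have := mul_le_mul_of_nonneg_left (hG b hb.1) hB0.le
      linarith
    have h2 : u b = B * Real.exp (G b) := by
      rw [hB, mul_assoc, ← Real.exp_add, neg_add_cancel, Real.exp_zero, mul_one]
    have h3 : B * Real.exp (G b) ≤ 2 * c := by linarith
    have h4 : B ≤ 2 * c := (le_mul_of_one_le_right hB0.le
      (Real.one_le_exp (hGb b hb.1).1)).trans h3
    calc u t ≤ B * Real.exp (G t) := hmax' t ⟨ht, le_rfl⟩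
      _ ≤ 2 * c * Real.exp M := mul_le_mul h4 (Real.exp_le_exp.2 (hGb t ht).2)
          (Real.exp_pos _).le (hB0.le.trans h4)
      _ = _ := by ring

end QuasilinearODE

/-! ### The linear flow and variation of constants. -/

namespace QuasilinearODE

section Flow

variable {V : Type*} [NormedAddCommGroup V] [NormedSpace ℝ V]

/-- The flow `exp (t L)` of the linear equation `x' = L x`. -/
noncomputable def flow (L : V →L[ℝ] V) (t : ℝ) : V →L[ℝ] V := NormedSpace.exp (t • L)

theorem flow_zero (L : V →L[ℝ] V) : flow L 0 = 1 := by simp [flow]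

variable [CompleteSpace V]

theorem flow_add (L : V →L[ℝ] V) (s t : ℝ) : flow L (s + t) = flow L s * flow L t := by
  let _ : NormedAlgebra ℚ (V →L[ℝ] V) := NormedAlgebra.restrictScalars ℚ ℝ _
  rw [flow, add_smul]
  exact NormedSpace.exp_add_of_commute (((Commute.refl L).smul_left s).smul_right t)

theorem flow_add_apply (L : V →L[ℝ] V) (s t : ℝ) (v : V) :
    flow L s (flow L t v) = flow L (s + t) v := by
  rw [flow_add]; rfl

theorem hasDerivAt_flow (L : V →L[ℝ] V) (t : ℝ) : HasDerivAt (flow L) (L * flow L t) t :=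
  hasDerivAt_exp_smul_const' L t

theorem commute_flow (L : V →L[ℝ] V) (t : ℝ) : flow L t * L = L * flow L t :=
  (hasDerivAt_exp_smul_const L t).unique (hasDerivAt_flow L t)

theorem continuous_flow (L : V →L[ℝ] V) : Continuous (flow L) :=
  continuous_iff_continuousAt.2 fun t => (hasDerivAt_flow L t).continuousAt

theorem continuous_flow_apply (L : V →L[ℝ] V) {b : ℝ → ℝ} (hb : Continuous b) {p : ℝ → V}
    (hp : Continuous p) : Continuous fun s => flow L (b s) (p s) :=
  ((continuous_flow L).comp hb).clm_apply hp

/-- The variation of constants formula. -/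
theorem eq_flow_add_integral (L : V →L[ℝ] V) {a : ℝ} {y p : ℝ → V} (hp : Continuous p)
    (hy : ∀ t, a ≤ t → HasDerivWithinAt y (L (y t) + p t) (Ici a) t) {t : ℝ} (ht : a ≤ t) :
    y t = flow L (t - a) (y a) + ∫ s in Ioc a t, flow L (t - s) (p s) := by
  have hder : ∀ s, a ≤ s →
      HasDerivWithinAt (fun τ => flow L (t - τ) (y τ)) (flow L (t - s) (p s)) (Ici a) s := by
    intro s hs
    have h1 : HasDerivAt (fun τ => flow L (t - τ)) (-(L * flow L (t - s))) s := by
      exact ((hasDerivAt_flow L (t - s)).scomp s ((hasDerivAt_id s).const_sub t)).congr_deriv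
        (by simp)
    refine (h1.hasDerivWithinAt.clm_apply (hy s hs)).congr_deriv ?_
    rw [← commute_flow]
    simp
  have hint := intervalIntegral.integral_eq_sub_of_hasDeriv_right_of_le ht
    (fun s hs => ((hder s hs.1).continuousWithinAt).mono Icc_subset_Ici_self)
    (fun s hs => (hder s hs.1.le).mono fun τ hτ => (hs.1.le.trans (le_of_lt hτ)))
    ((continuous_flow_apply L (continuous_const.sub continuous_id) hp).intervalIntegrable _ _)
  rw [← intervalIntegral.integral_of_le ht, hint, sub_self, flow_zero]
  simp

theorem hasDerivWithinAt_setIntegral_Ioi_flow (L : V →L[ℝ] V) {a : ℝ} {p : ℝ → V}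
    (hp : Continuous p) (hint : ∀ t, a ≤ t → IntegrableOn (fun s => flow L (t - s) (p s)) (Ioi t))
    {t : ℝ} (ht : a ≤ t) :
    HasDerivWithinAt (fun τ => ∫ s in Ioi τ, flow L (τ - s) (p s))
      (L (∫ s in Ioi t, flow L (t - s) (p s)) - p t) (Ici a) t := by
  have hcont : Continuous fun s => flow L (a - s) (p s) :=
    continuous_flow_apply L (continuous_const.sub continuous_id) hp
  -- Factoring out the flow from `a` to `τ` leaves `τ` only in the outer operator and in a limit of
  -- integration, so the product rule applies.
  have heq : ∀ τ, a ≤ τ → ∫ s in Ioi τ, flow L (τ - s) (p s)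
      = flow L (τ - a) ((∫ s in Ioi a, flow L (a - s) (p s)) -
        ∫ s in a..τ, flow L (a - s) (p s)) := by
    intro τ hτ
    have h1 := intervalIntegral.integral_Ioi_sub_Ioi (hint a le_rfl) hτ
    rw [← h1, sub_sub_cancel, ← ContinuousLinearMap.integral_comp_comm _
      ((hint a le_rfl).mono_set (Ioi_subset_Ioi hτ))]
    simp only [flow_add_apply, sub_add_sub_cancel]
  have hd1 : HasDerivAt (fun τ => (∫ s in Ioi a, flow L (a - s) (p s)) -
      ∫ s in a..τ, flow L (a - s) (p s)) (-flow L (a - t) (p t)) t :=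
    (hcont.integral_hasStrictDerivAt a t).hasDerivAt.const_sub _
  have hd2 : HasDerivAt (fun τ => flow L (τ - a)) (L * flow L (t - a)) t := by
    exact ((hasDerivAt_flow L (t - a)).scomp t ((hasDerivAt_id t).sub_const a)).congr_deriv
      (one_smul ℝ _)
  refine ((hd2.clm_apply hd1).hasDerivWithinAt.congr (fun τ hτ => heq τ hτ)
    (heq t ht)).congr_deriv ?_
  rw [heq t ht, map_neg, flow_add_apply, sub_add_sub_cancel, sub_self, flow_zero]
  simp [sub_eq_add_neg]

end Flow

end QuasilinearODE

/-! ### Dominated perturbations and dependence on the initial value. -/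

namespace QuasilinearODE

variable {n : ℕ}

/-- The vector field `(t, y) ↦ L y + f(t, y)`. -/
def perturbedField (L : E n →L[ℝ] E n) (f : ℝ → E n → E n) : ℝ → E n → E n :=
  fun t y => L y + f t y

theorem continuous_IciExtend {a : ℝ} (y : C(Ici a, E n)) : Continuous (IciExtend y) :=
  y.continuous.comp ((continuous_const.max continuous_id).subtype_mk _)

theorem continuous_forcing {a : ℝ} {f : ℝ → E n → E n}
    (hf : Continuous fun p : ℝ × E n => f p.1 p.2) (y : C(Ici a, E n)) :
    Continuous fun s => f s (IciExtend y s) :=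
  hf.comp (continuous_id.prodMk (continuous_IciExtend y))

theorem hasDerivWithinAt_of_mem_solutions {a : ℝ} {L : E n →L[ℝ] E n} {f : ℝ → E n → E n}
    {y : C(Ici a, E n)} (hy : y ∈ Solutions (perturbedField L f) a) {t : ℝ} (ht : a ≤ t) :
    HasDerivWithinAt (IciExtend y) (L (IciExtend y t) + f t (IciExtend y t)) (Ici a) t := by
  rw [IciExtend_of_mem y ht]
  exact hy ⟨t, ht⟩

/-- `f` is Lipschitz in the second variable, with a constant `η t` that is small with respect to
the flow of `L`, the smallness being measured by the growth function `g` and the integrable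
function `h`. -/
structure IsDominatedPerturbation (L : E n →L[ℝ] E n) (f : ℝ → E n → E n) (a : ℝ)
    (η g h : ℝ → ℝ) : Prop where
  continuous : Continuous fun p : ℝ × E n => f p.1 p.2
  map_zero : ∀ t, f t 0 = 0
  lipschitz : ∀ t, a ≤ t → ∀ x₁ x₂, ‖f t x₁ - f t x₂‖ ≤ η t * ‖x₁ - x₂‖
  nonneg : ∀ t, a ≤ t → 0 ≤ η t
  continuous_growth : Continuous g
  growth_pos : ∀ t, 0 < g t
  integrable : IntegrableOn h (Ioi a)
  kernel_le : ∀ t s, a ≤ t → a < s → ‖flow L (t - s)‖ * η s * g s ≤ h s * g t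

namespace IsDominatedPerturbation

variable {L : E n →L[ℝ] E n} {f : ℝ → E n → E n} {a : ℝ} {η g h : ℝ → ℝ}

theorem bound_nonneg (H : IsDominatedPerturbation L f a η g h) (s : ℝ) (hs : a < s) : 0 ≤ h s := by
  have h1 := H.kernel_le a s le_rfl hs
  have h2 := H.nonneg s hs.le
  have h3 := (H.growth_pos s).le
  exact nonneg_of_mul_nonneg_left (le_trans (by positivity) h1) (H.growth_pos a)

theorem norm_flow_sub_le (H : IsDominatedPerturbation L f a η g h) {t s : ℝ} (ht : a ≤ t)
    (hs : a < s) {x₁ x₂ : E n} {c : ℝ} (hc : 0 ≤ c) (hx : ‖x₁ - x₂‖ ≤ c * g s) :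
    ‖flow L (t - s) (f s x₁ - f s x₂)‖ ≤ h s * c * g t := by
  have h2 := H.nonneg s hs.le
  calc ‖flow L (t - s) (f s x₁ - f s x₂)‖ ≤ ‖flow L (t - s)‖ * (η s * (c * g s)) := by
        refine (ContinuousLinearMap.le_opNorm _ _).trans ?_
        gcongr
        exact (H.lipschitz s hs.le _ _).trans (mul_le_mul_of_nonneg_left hx h2)
    _ = c * (‖flow L (t - s)‖ * η s * g s) := by ring
    _ ≤ c * (h s * g t) := by
        exact mul_le_mul_of_nonneg_left (H.kernel_le t s ht hs) hc
    _ = _ := by ring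

theorem norm_flow_le (H : IsDominatedPerturbation L f a η g h) {t s : ℝ} (ht : a ≤ t)
    (hs : a < s) {x : E n} {c : ℝ} (hc : 0 ≤ c) (hx : ‖x‖ ≤ c * g s) :
    ‖flow L (t - s) (f s x)‖ ≤ h s * c * g t := by
  simpa [H.map_zero] using H.norm_flow_sub_le ht hs (x₂ := 0) hc (by simpa using hx)

theorem integrableOn (H : IsDominatedPerturbation L f a η g h) {y : C(Ici a, E n)} {c : ℝ}
    (hc : 0 ≤ c) (hy : ∀ s, a ≤ s → ‖IciExtend y s‖ ≤ c * g s) {t : ℝ} (ht : a ≤ t) :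
    IntegrableOn (fun s => flow L (t - s) (f s (IciExtend y s))) (Ioi a) := by
  refine Integrable.mono' ((H.integrable.mul_const c).mul_const (g t))
    (continuous_flow_apply L (continuous_const.sub continuous_id)
      (continuous_forcing H.continuous y)).aestronglyMeasurable
    ((ae_restrict_iff' measurableSet_Ioi).2 (Eventually.of_forall fun s hs => ?_))
  exact H.norm_flow_le ht hs hc (hy s (le_of_lt hs))

/-- Solutions depend continuously on the initial value, in the norm weighted by `g`. -/
theorem exists_norm_sub_le (H : IsDominatedPerturbation L f a η g h) {K : ℝ} (hK : 0 ≤ K)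
    (hflow : ∀ t, a ≤ t → ‖flow L (t - a)‖ ≤ K * g t) :
    ∃ K' : ℝ, 0 ≤ K' ∧ ∀ y₁ ∈ Solutions (perturbedField L f) a,
      ∀ y₂ ∈ Solutions (perturbedField L f) a, ∀ t : Ici a,
        ‖y₁ t - y₂ t‖ ≤ K' * ‖y₁ ⟨a, self_mem_Ici⟩ - y₂ ⟨a, self_mem_Ici⟩‖ * g t := by
  obtain ⟨K', hK', hG⟩ := exists_bound_of_le_add_setIntegral H.integrable H.bound_nonneg
  refine ⟨K' * K, mul_nonneg hK' hK, fun y₁ hy₁ y₂ hy₂ => ?_⟩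
  set δ : ℝ → E n := fun t => IciExtend y₁ t - IciExtend y₂ t with hδ
  set u : ℝ → ℝ := fun t => ‖δ t‖ / g t with hu
  have hδc : Continuous δ := (continuous_IciExtend y₁).sub (continuous_IciExtend y₂)
  have huc : Continuous u := hδc.norm.div H.continuous_growth fun t => (H.growth_pos t).ne'
  have hδu : ∀ t, ‖δ t‖ = u t * g t := fun t => (div_mul_cancel₀ _ (H.growth_pos t).ne').symm
  have hp : Continuous fun s => f s (IciExtend y₁ s) - f s (IciExtend y₂ s) :=
    (continuous_forcing H.continuous y₁).sub (continuous_forcing H.continuous y₂)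
  -- Variation of constants for the difference of the solutions, divided by `g t`, is the hypothesis
  -- of Gronwall's inequality for `u`.
  have key : ∀ t, a ≤ t → u t ≤ K * ‖δ a‖ + ∫ s in Ioc a t, h s * u s := by
    intro t ht
    have hint : IntegrableOn (fun s => h s * u s) (Ioc a t) := by
      obtain ⟨D, hD⟩ := (isCompact_Icc (a := a) (b := t)).exists_bound_of_continuousOn
        huc.continuousOn
      exact Integrable.mul_bdd (c := D) (H.integrable.mono_set Ioc_subset_Ioi_self)
        huc.aestronglyMeasurable ((ae_restrict_iff' measurableSet_Ioc).2
          (Eventually.of_forall fun s hs => hD s (Ioc_subset_Icc_self hs)))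
    have h1 := eq_flow_add_integral L (y := δ) hp (fun τ hτ => by
      refine ((hasDerivWithinAt_of_mem_solutions hy₁ hτ).sub
        (hasDerivWithinAt_of_mem_solutions hy₂ hτ)).congr_deriv ?_
      rw [hδ, map_sub]
      abel) ht
    have h2 : ‖∫ s in Ioc a t, flow L (t - s) (f s (IciExtend y₁ s) - f s (IciExtend y₂ s))‖
        ≤ ∫ s in Ioc a t, h s * u s * g t := by
      refine norm_integral_le_of_norm_le (hint.mul_const _)
        ((ae_restrict_iff' measurableSet_Ioc).2 (Eventually.of_forall fun s hs => ?_))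
      exact H.norm_flow_sub_le ht hs.1 (div_nonneg (norm_nonneg _) (H.growth_pos s).le) (hδu s).le
    rw [integral_mul_const] at h2
    have h3 : ‖flow L (t - a) (δ a)‖ ≤ K * g t * ‖δ a‖ :=
      (ContinuousLinearMap.le_opNorm _ _).trans
        (mul_le_mul_of_nonneg_right (hflow t ht) (norm_nonneg _))
    rw [hu]
    rw [div_le_iff₀ (H.growth_pos t), h1]
    refine (norm_add_le _ _).trans ((add_le_add h3 h2).trans (le_of_eq ?_))
    ring
  intro t
  have h4 := hG u (K * ‖δ a‖) huc (mul_nonneg hK (norm_nonneg _)) key t t.2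
  have h5 : y₁ t - y₂ t = δ t := by simp [hδ]
  have h6 : y₁ ⟨a, self_mem_Ici⟩ - y₂ ⟨a, self_mem_Ici⟩ = δ a := by simp [hδ]
  rw [h5, h6, hδu, mul_assoc K' K]
  exact mul_le_mul_of_nonneg_right h4 (H.growth_pos _).le

end IsDominatedPerturbation

end QuasilinearODE

/-! ### Weighted function spaces and the homeomorphism of solutions. -/

namespace QuasilinearODE

open scoped BoundedContinuousFunction

variable {n : ℕ}

/-- Multiplication of a bounded function by the weight `w`. -/
noncomputable def weighted {a : ℝ} {w : ℝ → ℝ} (hw : Continuous w) (z : Ici a →ᵇ E n) :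
    C(Ici a, E n) :=
  ⟨fun t => w t • z t, (hw.comp continuous_subtype_val).smul z.continuous⟩

theorem weighted_apply {a : ℝ} {w : ℝ → ℝ} (hw : Continuous w) (z : Ici a →ᵇ E n) (t : Ici a) :
    weighted hw z t = w t • z t := rfl

theorem continuous_weighted {a : ℝ} {w : ℝ → ℝ} (hw : Continuous w) :
    Continuous (weighted (n := n) (a := a) hw) := by
  refine ContinuousMap.continuous_of_continuous_uncurry _ ?_
  exact ((hw.comp continuous_subtype_val).comp continuous_snd).smul continuous_eval

theorem norm_IciExtend_weighted_sub_le {a : ℝ} {w : ℝ → ℝ} (hw : Continuous w)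
    (hw0 : ∀ t, 0 < w t) (z₁ z₂ : Ici a →ᵇ E n) {s : ℝ} (hs : a ≤ s) :
    ‖IciExtend (weighted hw z₁) s - IciExtend (weighted hw z₂) s‖ ≤ ‖z₁ - z₂‖ * w s := by
  rw [IciExtend_of_mem _ hs, IciExtend_of_mem _ hs, weighted_apply, weighted_apply, ← smul_sub,
    norm_smul, Real.norm_of_nonneg (hw0 s).le, mul_comm]
  exact mul_le_mul_of_nonneg_right ((z₁ - z₂).norm_coe_le_norm _) (hw0 s).le

theorem norm_IciExtend_weighted_le {a : ℝ} {w : ℝ → ℝ} (hw : Continuous w)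
    (hw0 : ∀ t, 0 < w t) (z : Ici a →ᵇ E n) {s : ℝ} (hs : a ≤ s) :
    ‖IciExtend (weighted hw z) s‖ ≤ ‖z‖ * w s := by
  rw [IciExtend_of_mem _ hs, weighted_apply, norm_smul, Real.norm_of_nonneg (hw0 s).le, mul_comm]
  exact mul_le_mul_of_nonneg_right (z.norm_coe_le_norm _) (hw0 s).le

/-- Division by the weight `w` of a function that is bounded by a multiple of `w`. -/
noncomputable def unweighted {a : ℝ} {w : ℝ → ℝ} (hw : Continuous w) (hw0 : ∀ t, 0 < w t)
    (y : C(Ici a, E n)) (c : ℝ) (hy : ∀ t, ‖y t‖ ≤ c * w t) : Ici a →ᵇ E n :=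
  BoundedContinuousFunction.ofNormedAddCommGroup (fun t => (w t)⁻¹ • y t)
    (((hw.comp continuous_subtype_val).inv₀ fun t => (hw0 t.1).ne').smul y.continuous) c
    (fun t => by
      rw [norm_smul, norm_inv, Real.norm_of_nonneg (hw0 t).le, inv_mul_le_iff₀ (hw0 t),
        mul_comm (w t)]
      exact hy t)

theorem weighted_unweighted {a : ℝ} {w : ℝ → ℝ} (hw : Continuous w) (hw0 : ∀ t, 0 < w t)
    {y : C(Ici a, E n)} {c : ℝ} (hy : ∀ t, ‖y t‖ ≤ c * w t) :
    weighted hw (unweighted hw hw0 y c hy) = y := by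
  ext1 t
  exact smul_inv_smul₀ (hw0 t).ne' _

/-- If solutions are Lipschitz functions of their initial values in a weighted norm, then the
space of solutions is homeomorphic to a subspace of the space of bounded functions. -/
noncomputable def weightedSolutionsHomeomorph {a : ℝ} {F : ℝ → E n → E n} {w : ℝ → ℝ}
    (hw : Continuous w) (hw0 : ∀ t, 0 < w t) (h0 : (0 : C(Ici a, E n)) ∈ Solutions F a)
    {K : ℝ} (hK : ∀ y₁ ∈ Solutions F a, ∀ y₂ ∈ Solutions F a, ∀ t : Ici a,
      ‖y₁ t - y₂ t‖ ≤ K * ‖y₁ ⟨a, self_mem_Ici⟩ - y₂ ⟨a, self_mem_Ici⟩‖ * w t) :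
    {z : Ici a →ᵇ E n // weighted hw z ∈ Solutions F a} ≃ₜ Solutions F a where
  toFun z := ⟨weighted hw z.1, z.2⟩
  invFun y := ⟨unweighted hw hw0 y.1 (K * ‖y.1 ⟨a, self_mem_Ici⟩‖)
      (fun t => by simpa using hK y.1 y.2 0 h0 t), by rw [weighted_unweighted]; exact y.2⟩
  left_inv z := by
    apply Subtype.ext
    ext1 t
    exact inv_smul_smul₀ (hw0 t).ne' _
  right_inv y := Subtype.ext (weighted_unweighted hw hw0 fun t => by
    simpa using hK y.1 y.2 0 h0 t)
  continuous_toFun := ((continuous_weighted hw).comp continuous_subtype_val).subtype_mk _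
  continuous_invFun := by
    refine Continuous.subtype_mk ?_ _
    have hev : Continuous fun y : Solutions F a => y.1 ⟨a, self_mem_Ici⟩ :=
      (ContinuousEvalConst.continuous_eval_const _).comp continuous_subtype_val
    rw [continuous_iff_continuousAt]
    intro y₀
    -- The weighted distance is at most `|K|` times the distance of the initial values, and
    -- evaluation at `a` is continuous for compact convergence.
    refine tendsto_iff_dist_tendsto_zero.2 ?_
    have hlim : Tendsto (fun y : Solutions F a =>
        |K| * ‖y.1 ⟨a, self_mem_Ici⟩ - y₀.1 ⟨a, self_mem_Ici⟩‖) (𝓝 y₀) (𝓝 0) := by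
      have : Continuous fun y : Solutions F a =>
        |K| * ‖y.1 ⟨a, self_mem_Ici⟩ - y₀.1 ⟨a, self_mem_Ici⟩‖ :=
        continuous_const.mul (hev.sub continuous_const).norm
      simpa using this.tendsto y₀
    refine squeeze_zero (fun _ => dist_nonneg) (fun y => ?_) hlim
    refine (BoundedContinuousFunction.dist_le (by positivity)).2 fun t => ?_
    change dist ((w t)⁻¹ • y.1 t) ((w t)⁻¹ • y₀.1 t) ≤ _
    rw [dist_eq_norm, ← smul_sub, norm_smul, norm_inv, Real.norm_of_nonneg (hw0 t).le,
      inv_mul_le_iff₀ (hw0 t), mul_comm (w t)]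
    refine (hK y.1 y.2 y₀.1 y₀.2 t).trans ?_
    have := hw0 t
    gcongr
    exact le_abs_self K

theorem zero_mem_solutions_perturbedField {L : E n →L[ℝ] E n} {f : ℝ → E n → E n} {a : ℝ}
    (hf : ∀ t, f t 0 = 0) : (0 : C(Ici a, E n)) ∈ Solutions (perturbedField L f) a := by
  intro t
  have : IciExtend (0 : C(Ici a, E n)) = fun _ => (0 : E n) := rfl
  rw [this]
  exact (hasDerivWithinAt_const _ _ _).congr_deriv (by simp [perturbedField, hf])

/-- The difference between a solution of the linear equation and the corresponding solution of the
perturbed equation. -/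
noncomputable def tailIntegral {a : ℝ} (L : E n →L[ℝ] E n) (f : ℝ → E n → E n) (y : C(Ici a, E n))
    (t : ℝ) : E n :=
  ∫ s in Ioi t, flow L (t - s) (f s (IciExtend y s))

namespace IsDominatedPerturbation

variable {L : E n →L[ℝ] E n} {f : ℝ → E n → E n} {a : ℝ} {η g h : ℝ → ℝ}

/-- Allows the Gronwall estimate to be applied to the linear equation as well. -/
theorem zero (H : IsDominatedPerturbation L f a η g h) : IsDominatedPerturbation L 0 a η g h where
  continuous := continuous_const
  map_zero _ := rfl
  lipschitz t ht x₁ x₂ := by simpa using mul_nonneg (H.nonneg t ht) (norm_nonneg (x₁ - x₂))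
  nonneg := H.nonneg
  continuous_growth := H.continuous_growth
  growth_pos := H.growth_pos
  integrable := H.integrable
  kernel_le := H.kernel_le

theorem hasDerivWithinAt_tailIntegral (H : IsDominatedPerturbation L f a η g h) {y : C(Ici a, E n)}
    {c : ℝ} (hc : 0 ≤ c) (hy : ∀ s, a ≤ s → ‖IciExtend y s‖ ≤ c * g s) {t : ℝ} (ht : a ≤ t) :
    HasDerivWithinAt (tailIntegral L f y) (L (tailIntegral L f y t) - f t (IciExtend y t))
      (Ici a) t :=
  hasDerivWithinAt_setIntegral_Ioi_flow L (continuous_forcing H.continuous y)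
    (fun _ hτ => (H.integrableOn hc hy hτ).mono_set (Ioi_subset_Ioi hτ)) ht

theorem add_tailIntegral_mem_solutions_iff (H : IsDominatedPerturbation L f a η g h)
    {x y : C(Ici a, E n)} {c : ℝ} (hc : 0 ≤ c) (hy : ∀ s, a ≤ s → ‖IciExtend y s‖ ≤ c * g s)
    (hxy : ∀ t : Ici a, x t = y t + tailIntegral L f y t) :
    y ∈ Solutions (perturbedField L f) a ↔ x ∈ Solutions (fun _ v => L v) a := by
  have hx : ∀ τ ∈ Ici a, IciExtend x τ = IciExtend y τ + tailIntegral L f y τ := fun τ hτ => by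
    rw [IciExtend_of_mem _ hτ, IciExtend_of_mem _ hτ, hxy]
  have hy' : ∀ τ ∈ Ici a, IciExtend y τ = IciExtend x τ - tailIntegral L f y τ := fun τ hτ => by
    rw [hx τ hτ, add_sub_cancel_right]
  refine forall_congr' fun t => ?_
  have hV := H.hasDerivWithinAt_tailIntegral hc hy t.2
  rw [IciExtend_coe] at hV
  constructor
  · intro hd
    refine ((hd.add hV).congr hx (hx t t.2)).congr_deriv ?_
    simp only [perturbedField, hxy, map_add]
    abel
  · intro hd
    refine ((hd.sub hV).congr hy' (hy' t t.2)).congr_deriv ?_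
    simp only [perturbedField, hxy, map_add]
    abel

/-- The constants `c₁`, `c₂` only ensure that both tails converge; the Lipschitz estimate uses `c`
alone, and its factor 1/2 comes from the choice of `G`. -/
theorem norm_tailIntegral_sub_le (H : IsDominatedPerturbation L f a η g h) {G : ℝ → ℝ}
    (hGc : Continuous G) (hG0 : ∀ t, a ≤ t → 0 ≤ G t)
    (hG : ∀ t, a ≤ t → ∫ s in Ioi t, h s * Real.exp (-G s) ≤ 1 / 2 * Real.exp (-G t))
    {y₁ y₂ : C(Ici a, E n)} {c c₁ c₂ : ℝ} (hc : 0 ≤ c) (hc₁ : 0 ≤ c₁) (hc₂ : 0 ≤ c₂)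
    (hy₁ : ∀ s, a ≤ s → ‖IciExtend y₁ s‖ ≤ c₁ * g s)
    (hy₂ : ∀ s, a ≤ s → ‖IciExtend y₂ s‖ ≤ c₂ * g s)
    (hy : ∀ s, a ≤ s → ‖IciExtend y₁ s - IciExtend y₂ s‖ ≤ c * (g s * Real.exp (-G s)))
    {t : ℝ} (ht : a ≤ t) :
    ‖tailIntegral L f y₁ t - tailIntegral L f y₂ t‖ ≤ 1 / 2 * c * (g t * Real.exp (-G t)) := by
  have hsub : Ioi t ⊆ Ioi a := Ioi_subset_Ioi ht
  have hint : IntegrableOn (fun s => h s * Real.exp (-G s)) (Ioi t) :=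
    Integrable.mul_bdd (c := 1) (H.integrable.mono_set hsub)
      (Real.continuous_exp.comp hGc.neg).aestronglyMeasurable
      ((ae_restrict_iff' measurableSet_Ioi).2 (Eventually.of_forall fun s hs => by
        rw [Real.norm_of_nonneg (Real.exp_pos _).le, Real.exp_le_one_iff, neg_nonpos]
        exact hG0 s (le_of_lt (hsub hs))))
  rw [tailIntegral, tailIntegral, ← integral_sub ((H.integrableOn hc₁ hy₁ ht).mono_set hsub)
    ((H.integrableOn hc₂ hy₂ ht).mono_set hsub)]
  refine (norm_integral_le_of_norm_le (hint.mul_const (c * g t))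
    ((ae_restrict_iff' measurableSet_Ioi).2 (Eventually.of_forall fun s hs => ?_))).trans ?_
  · rw [← map_sub]
    refine (H.norm_flow_sub_le ht (hsub hs) (c := c * Real.exp (-G s)) (by positivity)
      ((hy s (le_of_lt (hsub hs))).trans (le_of_eq (by ring)))).trans (le_of_eq (by ring))
  · rw [integral_mul_const]
    calc _ ≤ 1 / 2 * Real.exp (-G t) * (c * g t) :=
          mul_le_mul_of_nonneg_right (hG t ht) (mul_nonneg hc (H.growth_pos t).le)
      _ = _ := by ring

/-- If the solutions of the linear equation and of the perturbed equation are both controlled by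
their initial values and the tails of the perturbation tend to zero, then the two equations are
asymptotically equivalent. -/
theorem asymptoticallyEquivalent (H : IsDominatedPerturbation L f a η g h) {K : ℝ} (hK : 0 ≤ K)
    (hflow : ∀ t, a ≤ t → ‖flow L (t - a)‖ ≤ K * g t) {k : ℝ → ℝ → ℝ}
    (hk : ∀ᶠ t in atTop, IntegrableOn (k t) (Ioi t) ∧
      ∀ s, t < s → ‖flow L (t - s)‖ * η s * g s ≤ k t s)
    (hk0 : Tendsto (fun t => ∫ s in Ioi t, k t s) atTop (𝓝 0)) :
    AsymptoticallyEquivalent (perturbedField L f) (fun _ v => L v) a := by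
  obtain ⟨G, M, hGc, hGb, hG, -⟩ := exists_monotone_weight H.integrable
  set w : ℝ → ℝ := fun t => g t * Real.exp (-G t) with hwdef
  have hw : Continuous w := H.continuous_growth.mul (Real.continuous_exp.comp hGc.neg)
  have hw0 : ∀ t, 0 < w t := fun t => mul_pos (H.growth_pos t) (Real.exp_pos _)
  have hwg : ∀ t, a ≤ t → w t ≤ g t := fun t ht => mul_le_of_le_one_right (H.growth_pos t).le
    (Real.exp_le_one_iff.2 (neg_nonpos.2 (hGb t ht).1))
  have hgw : ∀ t, a ≤ t → g t ≤ Real.exp M * w t := fun t ht => by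
    have h1 : 1 ≤ Real.exp M * Real.exp (-G t) := by
      rw [← Real.exp_add]
      exact Real.one_le_exp (by linarith [(hGb t ht).2])
    calc g t ≤ g t * (Real.exp M * Real.exp (-G t)) :=
          le_mul_of_one_le_right (H.growth_pos t).le h1
      _ = _ := by rw [hwdef]; ring
  have hbdd : ∀ z : Ici a →ᵇ E n, ∀ s, a ≤ s → ‖IciExtend (weighted hw z) s‖ ≤ ‖z‖ * g s :=
    fun z s hs => (norm_IciExtend_weighted_le hw hw0 z hs).trans
      (mul_le_mul_of_nonneg_left (hwg s hs) (norm_nonneg _))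
  have hV : ∀ z₁ z₂ : Ici a →ᵇ E n, ∀ t, a ≤ t →
      ‖tailIntegral L f (weighted hw z₁) t - tailIntegral L f (weighted hw z₂) t‖
        ≤ 1 / 2 * ‖z₁ - z₂‖ * w t := fun z₁ z₂ t ht =>
    H.norm_tailIntegral_sub_le hGc (fun t ht => (hGb t ht).1) hG (norm_nonneg _) (norm_nonneg z₁)
      (norm_nonneg z₂) (hbdd z₁) (hbdd z₂)
      (fun s hs => norm_IciExtend_weighted_sub_le hw hw0 z₁ z₂ hs) ht
  have hV0 : ∀ t, tailIntegral L f (weighted hw (0 : Ici a →ᵇ E n)) t = 0 := fun t => by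
    have : ∀ s, IciExtend (weighted hw (0 : Ici a →ᵇ E n)) s = 0 := fun s => smul_zero _
    simp [tailIntegral, this, H.map_zero]
  let T : (Ici a →ᵇ E n) → C(Ici a, E n) := fun z =>
    ⟨fun t => tailIntegral L f (weighted hw z) t, continuousOn_iff_continuous_domRestrict.1
      fun t ht => (H.hasDerivWithinAt_tailIntegral (norm_nonneg z) (hbdd z) ht).continuousWithinAt⟩
  have hT : ∀ z t, ‖T z t‖ ≤ 1 / 2 * ‖z‖ * w t := fun z t => by
    change ‖tailIntegral L f (weighted hw z) t‖ ≤ _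
    simpa [hV0] using hV z 0 t t.2
  let Φ : (Ici a →ᵇ E n) → (Ici a →ᵇ E n) := fun z => z + unweighted hw hw0 (T z) _ (hT z)
  have hΦ : ∀ z (t : Ici a), weighted hw (Φ z) t
      = weighted hw z t + tailIntegral L f (weighted hw z) t := fun z t => by
    have h1 := congrArg (fun y => y t) (weighted_unweighted hw hw0 (hT z))
    rw [weighted_apply] at h1
    simp only [weighted_apply, Φ, BoundedContinuousFunction.add_apply, smul_add, h1]
    rfl
  -- `Φ` differs from the identity by a map with Lipschitz constant 1/2, so it is a homeomorphism of
  -- the whole space. The trivial space is separated in `hhalf` because the identity has norm 0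
  -- there.
  have happrox : ApproximatesLinearOn Φ
      ((ContinuousLinearEquiv.refl ℝ (Ici a →ᵇ E n) : (Ici a →ᵇ E n) →L[ℝ] (Ici a →ᵇ E n)))
      univ (1 / 2) := by
    intro z₁ _ z₂ _
    refine (BoundedContinuousFunction.norm_le (by positivity)).2 fun t => ?_
    have h1 : (Φ z₁ - Φ z₂ - (ContinuousLinearEquiv.refl ℝ (Ici a →ᵇ E n) :
        (Ici a →ᵇ E n) →L[ℝ] (Ici a →ᵇ E n)) (z₁ - z₂)) t
        = (w t)⁻¹ • (tailIntegral L f (weighted hw z₁) t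
          - tailIntegral L f (weighted hw z₂) t) := by
      change z₁ t + (w t)⁻¹ • T z₁ t - (z₂ t + (w t)⁻¹ • T z₂ t) - (z₁ t - z₂ t) = _
      rw [smul_sub]
      change z₁ t + (w t)⁻¹ • T z₁ t - (z₂ t + (w t)⁻¹ • T z₂ t) - (z₁ t - z₂ t)
        = (w t)⁻¹ • T z₁ t - (w t)⁻¹ • T z₂ t
      abel
    rw [h1, norm_smul, norm_inv, Real.norm_of_nonneg (hw0 t).le, inv_mul_le_iff₀ (hw0 t),
      mul_comm (w t)]
    simpa using hV z₁ z₂ t t.2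
  have hhalf : Subsingleton (Ici a →ᵇ E n) ∨ (1 / 2 : NNReal) <
      ‖((ContinuousLinearEquiv.refl ℝ (Ici a →ᵇ E n)).symm :
        (Ici a →ᵇ E n) →L[ℝ] (Ici a →ᵇ E n))‖₊⁻¹ := by
    rcases subsingleton_or_nontrivial (Ici a →ᵇ E n) with hs | hs
    · exact Or.inl hs
    · right
      have : ‖((ContinuousLinearEquiv.refl ℝ (Ici a →ᵇ E n)).symm :
        (Ici a →ᵇ E n) →L[ℝ] (Ici a →ᵇ E n))‖₊ = 1 :=
        NNReal.eq ContinuousLinearMap.norm_id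
      rw [this, inv_one]
      exact NNReal.half_lt_self one_ne_zero
  let e : (Ici a →ᵇ E n) ≃ₜ (Ici a →ᵇ E n) := happrox.toHomeomorph Φ hhalf
  have he : ∀ z, e z = Φ z := fun z => rfl
  have hmem : ∀ z, weighted hw z ∈ Solutions (perturbedField L f) a ↔
      weighted hw (e z) ∈ Solutions (fun _ v => L v) a := fun z => by
    rw [he]
    exact H.add_tailIntegral_mem_solutions_iff (norm_nonneg z) (hbdd z) (hΦ z)
  obtain ⟨K₁, hK₁, hbound⟩ := H.exists_norm_sub_le hK hflow
  have hGeq : (fun _ v => L v) = perturbedField L 0 := by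
    funext t v
    simp [perturbedField]
  obtain ⟨K₂, hK₂, hlin⟩ := H.zero.exists_norm_sub_le hK hflow
  rw [← hGeq] at hlin
  have hfin : ∀ {F : ℝ → E n → E n} {c : ℝ}, 0 ≤ c →
      (∀ y₁ ∈ Solutions F a, ∀ y₂ ∈ Solutions F a, ∀ t : Ici a,
        ‖y₁ t - y₂ t‖ ≤ c * ‖y₁ ⟨a, self_mem_Ici⟩ - y₂ ⟨a, self_mem_Ici⟩‖ * g t) →
      ∀ y₁ ∈ Solutions F a, ∀ y₂ ∈ Solutions F a, ∀ t : Ici a, ‖y₁ t - y₂ t‖ ≤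
        (c * Real.exp M) * ‖y₁ ⟨a, self_mem_Ici⟩ - y₂ ⟨a, self_mem_Ici⟩‖ * w t := by
    intro F c hc hF y₁ hy₁ y₂ hy₂ t
    refine (hF y₁ hy₁ y₂ hy₂ t).trans ((mul_le_mul_of_nonneg_left (hgw t t.2)
      (by positivity)).trans (le_of_eq (by ring)))
  let eF := weightedSolutionsHomeomorph hw hw0 (zero_mem_solutions_perturbedField H.map_zero)
    (hfin hK₁ hbound)
  have h0 : (0 : C(Ici a, E n)) ∈ Solutions (fun _ v => L v) a :=
    hGeq ▸ zero_mem_solutions_perturbedField (f := 0) fun _ => rfl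
  let eG := weightedSolutionsHomeomorph hw hw0 h0 (hfin hK₂ hlin)
  refine ⟨eG.symm.trans ((e.subtype hmem).symm.trans eF), fun x => ?_⟩
  obtain ⟨x', rfl⟩ := eG.surjective x
  obtain ⟨⟨z, hz⟩, rfl⟩ := (e.subtype hmem).surjective x'
  have hdiff : ∀ t : Ici a, (eG (e.subtype hmem ⟨z, hz⟩)).1 t
      - ((eG.symm.trans ((e.subtype hmem).symm.trans eF)) (eG (e.subtype hmem ⟨z, hz⟩))).1 t
      = tailIntegral L f (weighted hw z) t := by
    intro t
    simp only [Homeomorph.trans_apply, Homeomorph.symm_apply_apply]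
    change weighted hw (Φ z) t - weighted hw z t = _
    rw [hΦ, add_sub_cancel_left]
  simp only [hdiff]
  -- This limit is unweighted, so `h` does not suffice and the sharper kernel `k` is used.
  have hlim : Tendsto (tailIntegral L f (weighted hw z)) atTop (𝓝 0) := by
    have h1 : Tendsto (fun t => ‖z‖ * ∫ s in Ioi t, k t s) atTop (𝓝 0) := by
      simpa using hk0.const_mul ‖z‖
    refine squeeze_zero_norm' ?_ h1
    filter_upwards [hk, eventually_ge_atTop a] with t ht hat
    rw [← integral_const_mul]
    refine norm_integral_le_of_norm_le (ht.1.const_mul _)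
      ((ae_restrict_iff' measurableSet_Ioi).2 (Eventually.of_forall fun s hs => ?_))
    have has : a ≤ s := hat.trans (le_of_lt hs)
    calc ‖flow L (t - s) (f s (IciExtend (weighted hw z) s))‖
        ≤ ‖flow L (t - s)‖ * (η s * (‖z‖ * g s)) := by
          refine (ContinuousLinearMap.le_opNorm _ _).trans
            (mul_le_mul_of_nonneg_left ?_ (norm_nonneg _))
          have h2 := H.lipschitz s has (IciExtend (weighted hw z) s) 0
          rw [H.map_zero, sub_zero, sub_zero] at h2
          exact h2.trans (mul_le_mul_of_nonneg_left (hbdd z s has) (H.nonneg s has))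
      _ = ‖z‖ * (‖flow L (t - s)‖ * η s * g s) := by ring
      _ ≤ ‖z‖ * k t s := mul_le_mul_of_nonneg_left (ht.2 s hs) (norm_nonneg _)
  exact hlim.comp (tendsto_comp_val_Ici_atTop.2 tendsto_id)

end IsDominatedPerturbation

end QuasilinearODE

/-! ### Kernel estimates from the growth of the flow. -/

namespace QuasilinearODE

theorem exists_norm_flow_le {n : ℕ} (C : Matrix (Fin n) (Fin n) ℝ) :
    ∃ K : ℝ, 0 ≤ K ∧ ∀ t : ℝ, 0 ≤ t →
      ‖flow (Matrix.toEuclideanCLM (n := Fin n) (𝕜 := ℝ) C) t‖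
        ≤ K * ((1 + t) ^ (maxElementaryDegree C (maxRe C) - 1) * Real.exp (maxRe C * t)) ∧
      ‖flow (Matrix.toEuclideanCLM (n := Fin n) (𝕜 := ℝ) C) (-t)‖
        ≤ K * ((1 + t) ^ (maxElementaryDegree C (minRe C) - 1) * Real.exp (-minRe C * t)) := by
  have hfin := finite_eigenRealParts C
  obtain ⟨K₁, hK₁, h₁⟩ := exists_norm_exp_le C (σ := 1) (r := maxRe C) abs_one
    (m := maxElementaryDegree C (maxRe C)) (fun z hz =>
      ⟨(one_mul z.re).le.trans (le_csSup hfin.bddAbove ⟨z, hz, rfl⟩), fun h => by rw [← h, one_mul]⟩)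
  obtain ⟨K₂, hK₂, h₂⟩ := exists_norm_exp_le C (σ := -1) (r := -minRe C) (by simp)
    (m := maxElementaryDegree C (minRe C)) (fun z hz =>
      ⟨(neg_one_mul z.re).le.trans (neg_le_neg (csInf_le hfin.bddBelow ⟨z, hz, rfl⟩)), fun h => by
        rw [show z.re = minRe C by linarith]⟩)
  refine ⟨max K₁ K₂, hK₁.trans (le_max_left _ _), fun t ht => ⟨?_, ?_⟩⟩
  · have := h₁ t ht
    rw [one_mul] at this
    exact this.trans (mul_le_mul_of_nonneg_right (le_max_left _ _) (by positivity))
  · have := h₂ t ht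
    rw [neg_one_mul] at this
    exact this.trans (mul_le_mul_of_nonneg_right (le_max_right _ _) (by positivity))

/-- The quotient `(1 + t) / t` is bounded only away from 0, hence the positive initial time. The
absolute value keeps the weight positive on all of `ℝ`. -/
theorem integrableOn_one_add_abs_pow_mul {m : ℕ} {c : ℝ} {η : ℝ → ℝ}
    (hη : IntegrableOn (fun t : ℝ => t ^ m * Real.exp (c * t) * η t) (Ioi 0)) {a : ℝ}
    (ha : 0 < a) :
    IntegrableOn (fun t : ℝ => (1 + |t|) ^ m * Real.exp (c * t) * η t) (Ioi a) := by
  have h1 : IntegrableOn (fun t : ℝ => ((1 + |t|) / t) ^ m * (t ^ m * Real.exp (c * t) * η t))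
      (Ioi a) := by
    refine Integrable.bdd_mul (c := (1 / a + 1) ^ m) (hη.mono_set (Ioi_subset_Ioi ha.le))
      (Measurable.aestronglyMeasurable (by fun_prop))
      ((ae_restrict_iff' measurableSet_Ioi).2 (Eventually.of_forall fun t ht => ?_))
    have ht : a < t := ht
    have ht0 : 0 < t := ha.trans ht
    rw [abs_of_pos ht0, norm_pow, Real.norm_of_nonneg (by positivity), add_div, div_self ht0.ne']
    gcongr
  refine h1.congr_fun (fun t ht => ?_) measurableSet_Ioi
  have ht0 : t ≠ 0 := (ha.trans ht).ne'
  simp only [div_pow]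
  field_simp

theorem integrableOn_one_add_abs_pow_mul_zero {m : ℕ} {c : ℝ} {η : ℝ → ℝ}
    (hη : IntegrableOn (fun t : ℝ => t ^ m * Real.exp (c * t) * η t) (Ioi 0))
    (hη' : IntegrableOn η (Ioc 0 1)) :
    IntegrableOn (fun t : ℝ => (1 + |t|) ^ m * Real.exp (c * t) * η t) (Ioi 0) := by
  rw [← Ioc_union_Ioi_eq_Ioi (zero_le_one (α := ℝ))]
  refine IntegrableOn.union ?_ (integrableOn_one_add_abs_pow_mul hη one_pos)
  have hc : Continuous fun t : ℝ => (1 + |t|) ^ m * Real.exp (c * t) := by fun_prop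
  obtain ⟨D, hD⟩ := (isCompact_Icc (a := (0 : ℝ)) (b := 1)).exists_bound_of_continuousOn
    hc.continuousOn
  exact Integrable.bdd_mul (c := D) hη' hc.aestronglyMeasurable
    ((ae_restrict_iff' measurableSet_Ioc).2
      (Eventually.of_forall fun s hs => hD s (Ioc_subset_Icc_self hs)))

/-- On `s > t > 0` one has `(s - t) / s ≤ 1`, so the integrand of (C₅) is dominated by `e^(αt)`
times that of (C₄). -/
theorem integrableOn_tail_kernel {p q : ℕ} {α β : ℝ} {η : ℝ → ℝ}
    (hη : IntegrableOn (fun t : ℝ => t ^ (p + q) * Real.exp ((β - α) * t) * η t) (Ioi 0)) {t : ℝ}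
    (ht : 0 < t) :
    IntegrableOn (fun s : ℝ => (s - t) ^ p * s ^ q * Real.exp (α * (t - s)) * Real.exp (β * s) *
      η s) (Ioi t) := by
  have h1 : IntegrableOn (fun s : ℝ => (((s - t) / s) ^ p * Real.exp (α * t)) *
      (s ^ (p + q) * Real.exp ((β - α) * s) * η s)) (Ioi t) := by
    refine Integrable.bdd_mul (c := Real.exp (α * t)) (hη.mono_set (Ioi_subset_Ioi ht.le))
      (Measurable.aestronglyMeasurable (by fun_prop))
      ((ae_restrict_iff' measurableSet_Ioi).2 (Eventually.of_forall fun s hs => ?_))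
    have hs : t < s := hs
    have hs0 : 0 < s := ht.trans hs
    have h2 : 0 ≤ (s - t) / s := div_nonneg (sub_nonneg.2 hs.le) hs0.le
    rw [Real.norm_of_nonneg (by positivity)]
    exact mul_le_of_le_one_left (Real.exp_pos _).le
      (pow_le_one₀ h2 ((div_le_one hs0).2 (by linarith)))
  refine h1.congr_fun (fun s hs => ?_) measurableSet_Ioi
  have hs0 : s ≠ 0 := (ht.trans hs).ne'
  have he : Real.exp (α * (t - s)) * Real.exp (β * s)
      = Real.exp (α * t) * Real.exp ((β - α) * s) := by
    rw [← Real.exp_add, ← Real.exp_add]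
    ring_nf
  simp only
  rw [mul_assoc ((s - t) ^ p * s ^ q), he, div_pow, pow_add]
  field_simp

section Kernel

variable {p q : ℕ} {α β t s K : ℝ}

theorem forward_kernel_le (hK : 0 ≤ K) (hαβ : α ≤ β) (hs : 0 ≤ s) (hst : s ≤ t) :
    K * ((1 + (t - s)) ^ q * Real.exp (β * (t - s))) * ((1 + |s|) ^ q * Real.exp (β * s))
      ≤ K * ((1 + |s|) ^ (p + q) * Real.exp ((β - α) * s)) *
        ((1 + |t|) ^ q * Real.exp (β * t)) := by
  have ht : 0 ≤ t := hs.trans hst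
  rw [abs_of_nonneg hs, abs_of_nonneg ht]
  have he : Real.exp (β * (t - s)) * Real.exp (β * s) = Real.exp (β * t) := by
    rw [← Real.exp_add]
    ring_nf
  have h1 : (1 + (t - s)) ^ q ≤ (1 + t) ^ q := by
    have : 0 ≤ 1 + (t - s) := by linarith
    gcongr
    linarith
  have h2 : (1 + s) ^ q ≤ (1 + s) ^ (p + q) * Real.exp ((β - α) * s) :=
    (pow_le_pow_right₀ (by linarith) (Nat.le_add_left q p)).trans
      (le_mul_of_one_le_right (by positivity)
        (Real.one_le_exp (mul_nonneg (sub_nonneg.2 hαβ) hs)))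
  calc _ = K * ((1 + s) ^ q) * ((1 + (t - s)) ^ q *
        (Real.exp (β * (t - s)) * Real.exp (β * s))) := by ring
    _ ≤ _ := by
      rw [he]
      gcongr

theorem backward_kernel_le (hK : 0 ≤ K) (hαβ : α ≤ β) (ht : 0 ≤ t) (hts : t ≤ s) :
    K * ((1 + (s - t)) ^ p * Real.exp (-α * (s - t))) * ((1 + |s|) ^ q * Real.exp (β * s))
      ≤ K * ((1 + |s|) ^ (p + q) * Real.exp ((β - α) * s)) *
        ((1 + |t|) ^ q * Real.exp (β * t)) := by
  have hs : 0 ≤ s := ht.trans hts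
  rw [abs_of_nonneg hs, abs_of_nonneg ht]
  have he : Real.exp (-α * (s - t)) * Real.exp (β * s)
      = Real.exp ((β - α) * s) * Real.exp (α * t) := by
    rw [← Real.exp_add, ← Real.exp_add]
    ring_nf
  have h1 : (1 + (s - t)) ^ p ≤ (1 + s) ^ p := by
    have : 0 ≤ 1 + (s - t) := by linarith
    gcongr
    linarith
  have h2 : Real.exp (α * t) ≤ (1 + t) ^ q * Real.exp (β * t) :=
    (Real.exp_le_exp.2 (mul_le_mul_of_nonneg_right hαβ ht)).trans
      (le_mul_of_one_le_left (Real.exp_pos _).le (one_le_pow₀ (by linarith)))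
  calc _ = K * ((1 + (s - t)) ^ p * (1 + s) ^ q *
        (Real.exp (-α * (s - t)) * Real.exp (β * s))) := by ring
    _ = K * ((1 + (s - t)) ^ p * (1 + s) ^ q * Real.exp ((β - α) * s)) * Real.exp (α * t) := by
      rw [he]
      ring
    _ ≤ K * ((1 + s) ^ p * (1 + s) ^ q * Real.exp ((β - α) * s)) *
        ((1 + t) ^ q * Real.exp (β * t)) := by gcongr
    _ = _ := by rw [pow_add]

/-- The flow estimate contains `1 + (s - t)` where (C₅) has `s - t`. Since `1 + (s - t) = s - (t -
1)`, (C₅) is used at time `t - 1`: the shift costs `e^α`, and `1 + s ≤ 2s` costs `2^q`. -/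
theorem backward_kernel_le_shift (hK : 0 ≤ K) (ht : 1 ≤ t) (hts : t < s) :
    K * ((1 + (s - t)) ^ p * Real.exp (-α * (s - t))) * ((1 + |s|) ^ q * Real.exp (β * s))
      ≤ K * 2 ^ q * Real.exp α * ((s - (t - 1)) ^ p * s ^ q * Real.exp (α * (t - 1 - s)) *
        Real.exp (β * s)) := by
  have hs : 1 ≤ s := ht.trans hts.le
  have hs0 : 0 ≤ s := by linarith
  rw [abs_of_nonneg hs0]
  have he : Real.exp (-α * (s - t)) = Real.exp α * Real.exp (α * (t - 1 - s)) := by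
    rw [← Real.exp_add]
    ring_nf
  have h1 : (1 + s) ^ q ≤ 2 ^ q * s ^ q := by
    rw [← mul_pow]
    gcongr
    linarith
  have h2 : 0 ≤ 1 + (s - t) := by linarith
  calc _ = K * (1 + (s - t)) ^ p * (Real.exp α * Real.exp (α * (t - 1 - s))) *
        (1 + s) ^ q * Real.exp (β * s) := by rw [he]; ring
    _ ≤ K * (1 + (s - t)) ^ p * (Real.exp α * Real.exp (α * (t - 1 - s))) *
        (2 ^ q * s ^ q) * Real.exp (β * s) := by gcongr
    _ = _ := by rw [show s - (t - 1) = 1 + (s - t) by ring]; ring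

end Kernel

theorem asymptoticallyEquivalent_of_flow_le {n : ℕ} {L : E n →L[ℝ] E n} {f : ℝ → E n → E n}
    (hf : Continuous fun x : ℝ × E n => f x.1 x.2) (hf0 : ∀ t, f t 0 = 0) {η : ℝ → ℝ}
    (hη : ∀ t, 0 ≤ t → 0 ≤ η t)
    (hlip : ∀ t, 0 ≤ t → ∀ x₁ x₂, ‖f t x₁ - f t x₂‖ ≤ η t * ‖x₁ - x₂‖)
    {p q : ℕ} {α β K : ℝ} (hαβ : α ≤ β) (hK : 0 ≤ K)
    (hflow : ∀ t, 0 ≤ t → ‖flow L t‖ ≤ K * ((1 + t) ^ q * Real.exp (β * t)) ∧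
      ‖flow L (-t)‖ ≤ K * ((1 + t) ^ p * Real.exp (-α * t)))
    (hint : IntegrableOn (fun t : ℝ => t ^ (p + q) * Real.exp ((β - α) * t) * η t) (Ioi 0))
    (hlim : Tendsto (fun t : ℝ => ∫ s in Ioi t,
      (s - t) ^ p * s ^ q * Real.exp (α * (t - s)) * Real.exp (β * s) * η s) atTop (𝓝 0))
    {a : ℝ} (ha : 0 ≤ a)
    (hinta : IntegrableOn
      (fun t : ℝ => (1 + |t|) ^ (p + q) * Real.exp ((β - α) * t) * η t) (Ioi a)) :
    AsymptoticallyEquivalent (perturbedField L f) (fun _ v => L v) a := by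
  have hback : ∀ t s, t < s → ‖flow L (t - s)‖
      ≤ K * ((1 + (s - t)) ^ p * Real.exp (-α * (s - t))) := fun t s hts => by
    have := (hflow (s - t) (sub_nonneg.2 hts.le)).2
    rwa [neg_sub] at this
  have H : IsDominatedPerturbation L f a η (fun t => (1 + |t|) ^ q * Real.exp (β * t))
      (fun t => K * ((1 + |t|) ^ (p + q) * Real.exp ((β - α) * t) * η t)) :=
    { continuous := hf
      map_zero := hf0
      lipschitz := fun t ht => hlip t (ha.trans ht)
      nonneg := fun t ht => hη t (ha.trans ht)
      continuous_growth := by fun_prop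
      growth_pos := fun t => by positivity
      integrable := hinta.const_mul K
      kernel_le := fun t s ht hs => by
        have hs0 : 0 ≤ s := ha.trans hs.le
        have hηs := hη s hs0
        have key : ‖flow L (t - s)‖ * ((1 + |s|) ^ q * Real.exp (β * s))
            ≤ K * ((1 + |s|) ^ (p + q) * Real.exp ((β - α) * s)) *
              ((1 + |t|) ^ q * Real.exp (β * t)) := by
          rcases le_or_gt s t with hst | hts
          · exact (mul_le_mul_of_nonneg_right (hflow (t - s) (sub_nonneg.2 hst)).1
              (by positivity)).trans (forward_kernel_le hK hαβ hs0 hst)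
          · exact (mul_le_mul_of_nonneg_right (hback t s hts) (by positivity)).trans
              (backward_kernel_le hK hαβ (ha.trans ht) hts.le)
        calc _ = η s * (‖flow L (t - s)‖ * ((1 + |s|) ^ q * Real.exp (β * s))) := by ring
          _ ≤ _ := mul_le_mul_of_nonneg_left key hηs
          _ = _ := by ring }
  have hlim' : Tendsto (fun t : ℝ => ∫ s in Ioi (t - 1), (s - (t - 1)) ^ p * s ^ q *
      Real.exp (α * (t - 1 - s)) * Real.exp (β * s) * η s) atTop (𝓝 0) :=
    hlim.comp (tendsto_atTop_add_const_right _ (-1) tendsto_id)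
  -- The factor `e^(-βa)` accounts for the flow starting at time `a` instead of 0.
  refine H.asymptoticallyEquivalent (K := K * Real.exp (-(β * a))) (by positivity)
    (fun t ht => ?_) (k := fun t s => K * 2 ^ q * Real.exp α * ((s - (t - 1)) ^ p * s ^ q *
      Real.exp (α * (t - 1 - s)) * Real.exp (β * s) * η s)) ?_ ?_
  · have h1 : 0 ≤ 1 + (t - a) := by linarith
    have h2 : 1 + (t - a) ≤ 1 + |t| := by linarith [le_abs_self t]
    calc _ ≤ K * ((1 + (t - a)) ^ q * Real.exp (β * (t - a))) := (hflow _ (sub_nonneg.2 ht)).1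
      _ ≤ K * ((1 + |t|) ^ q * Real.exp (β * (t - a))) := by gcongr
      _ = K * ((1 + |t|) ^ q * (Real.exp (-(β * a)) * Real.exp (β * t))) := by
        rw [← Real.exp_add]
        ring_nf
      _ = _ := by ring
  · filter_upwards [eventually_gt_atTop 1] with t ht
    refine ⟨((integrableOn_tail_kernel hint (by linarith)).mono_set
      (Ioi_subset_Ioi (by linarith))).const_mul _, fun s hts => ?_⟩
    have hηs := hη s (by linarith)
    calc _ = η s * (‖flow L (t - s)‖ * ((1 + |s|) ^ q * Real.exp (β * s))) := by ring
      _ ≤ η s * _ := mul_le_mul_of_nonneg_left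
          ((mul_le_mul_of_nonneg_right (hback t s hts) (by positivity)).trans
            (backward_kernel_le_shift hK ht.le hts)) hηs
      _ = _ := by ring
  · have h1 := hlim'.const_mul (K * 2 ^ q * Real.exp α)
    rw [mul_zero] at h1
    have hnn : ∀ t s : ℝ, 1 < t → t - 1 < s → 0 ≤ (s - (t - 1)) ^ p * s ^ q *
      Real.exp (α * (t - 1 - s)) * Real.exp (β * s) * η s := fun t s ht hs => by
      have h2 := hη s (by linarith)
      have h3 : 0 ≤ s - (t - 1) := by linarith
      have h4 : 0 ≤ s := by linarith
      positivity
    refine squeeze_zero' ?_ ?_ h1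
    · filter_upwards [eventually_gt_atTop 1] with t ht
      exact setIntegral_nonneg measurableSet_Ioi fun s hs =>
        mul_nonneg (by positivity) (hnn t s ht (by linarith [mem_Ioi.1 hs]))
    · filter_upwards [eventually_gt_atTop 1] with t ht
      rw [integral_const_mul]
      refine mul_le_mul_of_nonneg_left ?_ (by positivity)
      exact setIntegral_mono_set (integrableOn_tail_kernel hint (by linarith))
        ((ae_restrict_iff' measurableSet_Ioi).2 (Eventually.of_forall fun s hs => hnn t s ht hs))
        (Ioi_subset_Ioi (by linarith)).eventuallyLE

end QuasilinearODE


/-! ### The main theorem. -/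

theorem mainTheorem3 (n : ℕ) (hn : 1 ≤ n) (C : Matrix (Fin n) (Fin n) ℝ)
    (f : ℝ → EuclideanSpace ℝ (Fin n) → EuclideanSpace ℝ (Fin n))
    (hf : Continuous (fun p : ℝ × EuclideanSpace ℝ (Fin n) => f p.1 p.2))
    (hf0 : ∀ t : ℝ, f t 0 = 0)
    (η : ℝ → ℝ) (hη : ∀ t : ℝ, 0 ≤ t → 0 ≤ η t)
    (α β : ℝ) (hα : α = QuasilinearODE.minRe C) (hβ : β = QuasilinearODE.maxRe C)
    (mα mβ : ℕ) (hmα : mα = QuasilinearODE.maxElementaryDegree C α)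
    (hmβ : mβ = QuasilinearODE.maxElementaryDegree C β)
    (hC3 : ∀ t : ℝ, 0 ≤ t → ∀ x₁ x₂ : EuclideanSpace ℝ (Fin n),
      ‖f t x₁ - f t x₂‖ ≤ η t * ‖x₁ - x₂‖)
    (hC4 : IntegrableOn
      (fun t : ℝ => t ^ (mβ + mα - 2) * Real.exp ((β - α) * t) * η t) (Set.Ioi 0))
    (hC5 : Tendsto
      (fun t : ℝ => ∫ s in Set.Ioi t,
        (s - t) ^ (mα - 1) * s ^ (mβ - 1) * Real.exp (α * (t - s)) * Real.exp (β * s) * η s)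
      atTop (𝓝 0)) :
    (∀ t₀ : ℝ, 0 < t₀ →
      QuasilinearODE.AsymptoticallyEquivalent
        (QuasilinearODE.quasilinearField C f) (QuasilinearODE.linearField C) t₀) ∧
    (IntegrableOn η (Set.Ioc 0 1) →
      QuasilinearODE.AsymptoticallyEquivalent
        (QuasilinearODE.quasilinearField C f) (QuasilinearODE.linearField C) 0) := by
  have hmem_α : α ∈ QuasilinearODE.eigenRealParts C := hα ▸
    (QuasilinearODE.nonempty_eigenRealParts hn C).csInf_mem (QuasilinearODE.finite_eigenRealParts C)
  have hmem_β : β ∈ QuasilinearODE.eigenRealParts C := hβ ▸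
    (QuasilinearODE.nonempty_eigenRealParts hn C).csSup_mem (QuasilinearODE.finite_eigenRealParts C)
  have hαβ : α ≤ β :=
    hβ ▸ le_csSup (QuasilinearODE.finite_eigenRealParts C).bddAbove hmem_α
  have hmα1 : 1 ≤ mα := hmα ▸ QuasilinearODE.one_le_maxElementaryDegree_of_mem C hmem_α
  have hmβ1 : 1 ≤ mβ := hmβ ▸ QuasilinearODE.one_le_maxElementaryDegree_of_mem C hmem_β
  obtain ⟨K, hK, hflow⟩ := QuasilinearODE.exists_norm_flow_le C
  rw [← hα, ← hβ, ← hmα, ← hmβ] at hflow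
  -- Both degrees are at least 1, so the truncated subtractions agree.
  rw [show mβ + mα - 2 = mα - 1 + (mβ - 1) by omega] at hC4
  have main : ∀ a : ℝ, 0 ≤ a → IntegrableOn (fun t : ℝ =>
      (1 + |t|) ^ (mα - 1 + (mβ - 1)) * Real.exp ((β - α) * t) * η t) (Set.Ioi a) →
      QuasilinearODE.AsymptoticallyEquivalent
        (QuasilinearODE.quasilinearField C f) (QuasilinearODE.linearField C) a := fun a ha hint =>
    QuasilinearODE.asymptoticallyEquivalent_of_flow_le hf hf0 hη hC3 hαβ hK hflow hC4 hC5 ha hint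
  exact ⟨fun t₀ ht₀ => main t₀ ht₀.le (QuasilinearODE.integrableOn_one_add_abs_pow_mul hC4 ht₀),
    fun hη1 => main 0 le_rfl (QuasilinearODE.integrableOn_one_add_abs_pow_mul_zero hC4 hη1)⟩
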